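/- Consider the parameterised counting problem whose input is a finite bipartite graph $G=(U,V,E)$ with $E\subseteq U\times V$, together with a non-negative integer $k$, whose output is the number of independent sets of $G$ of size exactly $k$, and whose parameter is $k$. This problem is #W[1]-complete: it belongs to #W[1] and it is #W[1]-hard. Here the reference problem is counting cliques: given a finite graph $G$ and a positive integer $k$, output the number of $k$-cliques of $G$; the parameter is $k$. For an instance $x$ of a parameterised problem write $|x|$ for its size (taken to be at least $1$) and $k(x)$ for its parameter; running times refer to a word RAM whose words have a number of bits logarithmic in the permitted running time. - A parameterised counting problem $F$ belongs to #W[1] if it has an FPT parsimonious reduction to counting cliques, i.e. if there are a map $R$ from the instances of $F$ to those of the clique problem, computable functions $f,g:\mathbb{N}\to\mathbb{N}$ and a constant $c\in\mathbb{N}$ such that, for every instance $x$ of $F$, the number of cliques to be counted in $R(x)$ equals $F(x)$, $R(x)$ can be computed by one algorithm in time at most $f(k(x))\cdot|x|^c$, and the parameter of $R(x)$ is at most $g(k(x))$. - $F$ is #W[1]-hard if there is an FPT Turing reduction from counting cliques to $F$, i.e. an algorithm with an oracle for $F$, computable functions $f,g:\mathbb{N}\to\mathbb{N}$ and a constant $c\in\mathbb{N}$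 such that, on every instance $x$ of the clique problem, the algorithm outputs the number of cliques to be counted in time at most $f(k(x))\cdot|x|^c$, and every instance of $F$ on which it queries the oracle has parameter at most $g(k(x))$. -/

import Mathlib

/-! ## The word RAM

Registers and memory cells hold natural numbers. The registers are named by natural numbers, and so
are the arrays into which the memory is divided; a program mentions only finitely many of them.
Programs are built from word instructions with sequencing, branching and loops (jumps can be
simulated by these with constant overhead). Runs are considered relative to a bound `W`
on the words, that is, to words of about `log₂ W` bits: an instruction whose result exceeds `W`
cannot be executed. Every instruction and every test takes one step; a call of the oracle is
charged in addition the length of the question and of the answer. -/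

namespace WordRAM

/-- Binary operations on words (`sub` is truncated at `0`). -/
inductive Op where
  | add | sub | mul | div | mod | lt | eq | land | lor | xor | shl | shr

def Op.eval : Op → ℕ → ℕ → ℕ
  | .add, u, v => u + v
  | .sub, u, v => u - v
  | .mul, u, v => u * v
  | .div, u, v => u / v
  | .mod, u, v => u % v
  | .lt, u, v => if u < v then 1 else 0
  | .eq, u, v => if u = v then 1 else 0
  | .land, u, v => u &&& v
  | .lor, u, v => u ||| v
  | .xor, u, v => u ^^^ v
  | .shl, u, v => u <<< v
  | .shr, u, v => u >>> v

inductive Prog where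
  /-- do nothing -/
  | skip
  /-- `x := n` -/
  | const (x n : ℕ)
  /-- `x := y o z` -/
  | op (o : Op) (x y z : ℕ)
  /-- `x := a[i]`, where `x` and `i` are registers and `a` is an array -/
  | load (x a i : ℕ)
  /-- `a[i] := x`, where `x` and `i` are registers and `a` is an array -/
  | store (a i x : ℕ)
  /-- ask the oracle the bit string stored in array `a` whose length is in register `n`;
  the answer goes into array `b` and its length into register `m` -/
  | query (a n b m : ℕ)
  /-- first `p`, then `q` -/
  | seq (p q : Prog)
  /-- if register `x` is nonzero then `p`, else `q` -/
  | branch (x : ℕ) (p q : Prog)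
  /-- while register `x` is nonzero do `p` -/
  | loop (x : ℕ) (p : Prog)

/-- Contents of the registers and of the arrays. -/
@[ext]
structure State where
  reg : ℕ → ℕ
  mem : ℕ → ℕ → ℕ

namespace State

def setReg (s : State) (x v : ℕ) : State :=
  ⟨Function.update s.reg x v, s.mem⟩

def setMem (s : State) (a i v : ℕ) : State :=
  ⟨s.reg, Function.update s.mem a (Function.update (s.mem a) i v)⟩

/-- Register `n` holds the length of `l`, and array `a` starts with the bits of `l`. -/
def Holds (s : State) (a n : ℕ) (l : List Bool) : Prop :=
  s.reg n = l.length ∧ ∀ (i : ℕ) (h : i < l.length), s.mem a i = (l[i]'h).toNat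

/-- Overwrite the beginning of array `a` by `l`, and put the length of `l` into register `n`. -/
def write (s : State) (a n : ℕ) (l : List Bool) : State :=
  ⟨Function.update s.reg n l.length,
    Function.update s.mem a
      (fun i => if h : i < l.length then (l[i]'h).toNat else s.mem a i)⟩

/-- Start with input `l`: the bits in array `0`, the length in register `0`, all else `0`. -/
def init (l : List Bool) : State :=
  write ⟨fun _ => 0, fun _ _ => 0⟩ 0 0 l

end State

/-- `O q r` says that the oracle may be asked `q` and then answers `r`. -/
abbrev Oracle := List Bool → List Bool → Prop

/-- The oracle that cannot be asked anything. -/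
def noOracle : Oracle := fun _ _ => False

/-- `Exec W O p s t s'`: started in state `s`, the program `p` halts after exactly `t` steps in
state `s'`, with oracle `O`; all words produced are at most `W`, and every question
asked is one that `O` answers. -/
inductive Exec (W : ℕ) (O : Oracle) : Prog → State → ℕ → State → Prop
  | skip (s : State) : Exec W O .skip s 1 s
  | const (s : State) (x n : ℕ) (h : n ≤ W) :
      Exec W O (.const x n) s 1 (s.setReg x n)
  | op (s : State) (o : Op) (x y z : ℕ) (h : o.eval (s.reg y) (s.reg z) ≤ W) :
      Exec W O (.op o x y z) s 1 (s.setReg x (o.eval (s.reg y) (s.reg z)))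
  | load (s : State) (x a i : ℕ) :
      Exec W O (.load x a i) s 1 (s.setReg x (s.mem a (s.reg i)))
  | store (s : State) (a i x : ℕ) :
      Exec W O (.store a i x) s 1 (s.setMem a (s.reg i) (s.reg x))
  | query (s : State) (a n b m : ℕ) (q r : List Bool)
      (hq : s.Holds a n q) (hr : O q r) (h : r.length ≤ W) :
      Exec W O (.query a n b m) s (q.length + r.length + 1) (s.write b m r)
  | seq {p q : Prog} {s s' s'' : State} {t t' : ℕ}
      (h : Exec W O p s t s') (h' : Exec W O q s' t' s'') :
      Exec W O (.seq p q) s (t + t') s''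
  | branch_true {x : ℕ} {p q : Prog} {s s' : State} {t : ℕ}
      (hx : s.reg x ≠ 0) (h : Exec W O p s t s') :
      Exec W O (.branch x p q) s (t + 1) s'
  | branch_false {x : ℕ} {p q : Prog} {s s' : State} {t : ℕ}
      (hx : s.reg x = 0) (h : Exec W O q s t s') :
      Exec W O (.branch x p q) s (t + 1) s'
  | loop_true {x : ℕ} {p : Prog} {s s' s'' : State} {t t' : ℕ}
      (hx : s.reg x ≠ 0) (h : Exec W O p s t s') (h' : Exec W O (.loop x p) s' t' s'') :
      Exec W O (.loop x p) s (t + t' + 1) s''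
  | loop_false {x : ℕ} {p : Prog} {s : State} (hx : s.reg x = 0) :
      Exec W O (.loop x p) s 1 s

/-- With oracle `O`, the program `p` turns input `l` into output `r` (in array `1`, the length in
register `1`) in at most `B` steps, and all words, including the lengths of input and output,
are at most `B`. -/
def ComputesWithin (B : ℕ) (O : Oracle) (p : Prog) (l r : List Bool) : Prop :=
  l.length ≤ B ∧ ∃ t ≤ B, ∃ s, Exec B O p (State.init l) t s ∧ s.Holds 1 1 r

end WordRAM

/-! ## Parameterised counting problems and reductions -/

/-- A parameterised counting problem: instances, presented to machines as bit strings, each with a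
number to be computed and a parameter. -/
structure ParamCountingProblem where
  Instance : Type
  encode : Instance → List Bool
  encode_injective : Function.Injective encode
  count : Instance → ℕ
  param : Instance → ℕ

namespace ParamCountingProblem

/-- The size of an instance: the length of its encoding, plus one so that it is never zero. -/
def size (F : ParamCountingProblem) (x : F.Instance) : ℕ := (F.encode x).length + 1

/-- The oracle for `G`, restricted to questions with parameter at most `K`: the question is
an encoded instance, the answer is the number to be computed, in binary (least significant
bit first). -/
def oracle (G : ParamCountingProblem) (K : ℕ) : WordRAM.Oracle := fun q r =>
  ∃ y : G.Instance, G.encode y = q ∧ G.param y ≤ K ∧ r = (G.count y).bits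

/-- There is an FPT Turing reduction from `F` to `G`. -/
def FPTTuringReducible (F G : ParamCountingProblem) : Prop :=
  ∃ (p : WordRAM.Prog) (f g : ℕ → ℕ) (c : ℕ), Computable f ∧ Computable g ∧
    ∀ x : F.Instance,
      WordRAM.ComputesWithin (f (F.param x) * F.size x ^ c) (G.oracle (g (F.param x))) p
        (F.encode x) (F.count x).bits

/-- There is an FPT parsimonious reduction from `F` to `G`. -/
def FPTParsimoniousReducible (F G : ParamCountingProblem) : Prop :=
  ∃ R : F.Instance → G.Instance,
    (∀ x, F.count x = G.count (R x)) ∧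
    (∃ (p : WordRAM.Prog) (f : ℕ → ℕ) (c : ℕ), Computable f ∧
      ∀ x, WordRAM.ComputesWithin (f (F.param x) * F.size x ^ c) WordRAM.noOracle p
        (F.encode x) (G.encode (R x))) ∧
    (∃ g : ℕ → ℕ, Computable g ∧ ∀ x, G.param (R x) ≤ g (F.param x))

end ParamCountingProblem

/-! ## Encodings -/

/-- The number `n` in unary, followed by `l`. -/
def unaryThen (n : ℕ) (l : List Bool) : List Bool := List.replicate n true ++ false :: l

theorem unaryThen_inj {m n : ℕ} {l l' : List Bool} (h : unaryThen m l = unaryThen n l') :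
    m = n ∧ l = l' := by
  induction m generalizing n with
  | zero => cases n <;> simp_all [unaryThen, List.replicate_succ]
  | succ m ih =>
    cases n with
    | zero => simp [unaryThen, List.replicate_succ] at h
    | succ n =>
      have := @ih n (by simpa [unaryThen, List.replicate_succ] using h)
      exact ⟨by rw [this.1], this.2⟩

open Classical in
/-- The `a × b` matrix of a relation, row after row: the entry at `(u, v)` has
position `u * b + v`. -/
noncomputable def matrixBits {a b : ℕ} (r : Fin a → Fin b → Prop) : List Bool :=
  List.ofFn fun i : Fin (a * b) =>
    decide (r (finProdFinEquiv.symm i).1 (finProdFinEquiv.symm i).2)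

theorem matrixBits_injective {a b : ℕ} : Function.Injective (@matrixBits a b) := by
  intro r r' h
  have h' := List.ofFn_injective h
  funext u v
  have := congrFun h' (finProdFinEquiv (u, v))
  simpa using this

/-! ## Counting cliques -/

structure CliqueInstance where
  n : ℕ
  G : SimpleGraph (Fin n)
  k : ℕ
  k_pos : 0 < k

namespace CliqueInstance

/-- `n` and `k` in unary, then the adjacency matrix. -/
noncomputable def encode (x : CliqueInstance) : List Bool :=
  unaryThen x.n (unaryThen x.k (matrixBits x.G.Adj))

theorem encode_injective : Function.Injective encode := by
  rintro ⟨n, G, k, hk⟩ ⟨n', G', k', hk'⟩ h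
  obtain ⟨h1, h2⟩ := unaryThen_inj h
  obtain ⟨h3, h4⟩ := unaryThen_inj h2
  dsimp only at h1 h3 h4
  subst h1 h3
  have := SimpleGraph.ext (matrixBits_injective h4)
  subst this
  rfl

end CliqueInstance

/-- Given a graph and a positive integer `k`, count the `k`-cliques; the parameter is `k`. -/
noncomputable def countCliques : ParamCountingProblem where
  Instance := CliqueInstance
  encode := CliqueInstance.encode
  encode_injective := CliqueInstance.encode_injective
  count x := Set.ncard {s : Finset (Fin x.n) | x.G.IsNClique x.k s}
  param x := x.k

/-! ## Counting independent sets in bipartite graphs -/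

/-- A finite bipartite graph `(U, V, E)` with `U = Fin left`, `V = Fin right`, `E ⊆ U × V`. -/
structure BipartiteGraph where
  left : ℕ
  right : ℕ
  edges : Set (Fin left × Fin right)

/-- The graph on the disjoint union of `U` and `V`. -/
def BipartiteGraph.toSimpleGraph (B : BipartiteGraph) :
    SimpleGraph (Fin B.left ⊕ Fin B.right) :=
  SimpleGraph.fromRel fun x y => ∃ e ∈ B.edges, x = .inl e.1 ∧ y = .inr e.2

structure BISInstance where
  G : BipartiteGraph
  k : ℕ

namespace BISInstance

/-- `|U|`, `|V|` and `k` in unary, then the `U × V` adjacency matrix. -/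
noncomputable def encode (x : BISInstance) : List Bool :=
  unaryThen x.G.left (unaryThen x.G.right (unaryThen x.k
    (matrixBits fun u v => (u, v) ∈ x.G.edges)))

theorem encode_injective : Function.Injective encode := by
  rintro ⟨⟨a, b, E⟩, k⟩ ⟨⟨a', b', E'⟩, k'⟩ h
  obtain ⟨h1, h2⟩ := unaryThen_inj h
  obtain ⟨h3, h4⟩ := unaryThen_inj h2
  obtain ⟨h5, h6⟩ := unaryThen_inj h4
  dsimp only at h1 h3 h5 h6
  subst h1 h3 h5
  have h7 := matrixBits_injective h6
  have : E = E' := by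
    ext ⟨u, v⟩
    exact iff_of_eq (congrFun (congrFun h7 u) v)
  subst this
  rfl

end BISInstance

/-- Given a bipartite graph and a non-negative integer `k`, count the independent sets of size `k`;
the parameter is `k`. -/
noncomputable def countSizeBIS : ParamCountingProblem where
  Instance := BISInstance
  encode := BISInstance.encode
  encode_injective := BISInstance.encode_injective
  count x := Set.ncard {s : Finset (Fin x.G.left ⊕ Fin x.G.right) |
    x.G.toSimpleGraph.IsNIndepSet x.k s}
  param x := x.k

/-! ## The class #W[1] -/

/-- The class #W[1]: the parameterised counting problems with an FPT parsimonious reduction to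
counting `k`-cliques. -/
def SharpW1 : Set ParamCountingProblem := {F | F.FPTParsimoniousReducible countCliques}

/-- #W[1]-hardness, under FPT Turing reductions. -/
def SharpW1Hard (F : ParamCountingProblem) : Prop := countCliques.FPTTuringReducible F

def SharpW1Complete (F : ParamCountingProblem) : Prop := F ∈ SharpW1 ∧ SharpW1Hard F

/-! Membership. An independent set of a graph is a clique of its complement, so a bipartite graph is
mapped to the complement of its disjoint-union graph with the same `k`. Only `k = 0` needs care,
since clique instances have positive parameter: there the empty set is the only independent set, and
the one-vertex graph with parameter `1` has one clique as well (`BISInstance.count_toClique`). The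
new matrix is written in quadratic time (`run_complementReduction`).

Hardness. Given a graph on `n` vertices and `k`, take `2 * k` copies (groups) of the vertex set, `k`
on each side of a bipartite graph. The left vertex `(i, u)` and the right vertex `(k + j, v)` are
non-adjacent iff `i = j` and `u = v`, or `i < j`, `u < v` and `u`, `v` are adjacent in the graph, or
`j < i`. An independent set of size `2 * k` that meets every group has one vertex in each; the pairs
with `i = j` force both sides to carry the same sequence, and the pairs with `i < j` make it the
increasing enumeration of a clique. So these sets correspond to the `k`-cliques, each counted once
(`Selector.colourful_iff`, `Selector.card_colourful`).

The oracle cannot require that every group is met. Inclusion-exclusion over the `4 ^ k` sets of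
groups does this (`Selector.sum_maskCount`): each term counts independent sets of size `2 * k` in an
induced bipartite subgraph, which is a single query with parameter `2 * k`
(`Selector.count_maskInstance`).

The answers can have about `2 * k * n` bits and do not fit into words. Their binary digits are
therefore accumulated position by position, separately for masks of even and of odd weight
(`Selector.sum_digitSum`), and one subtraction with carries at the end produces the binary expansion
of the number of cliques (`testBit_eq_carry`).

Programs are verified compositionally: `Run` describes an execution up to scratch registers and
arrays, and `Emits` describes one that only appends bits to an array. -/

namespace WordRAM

/-! ## Structured programs and their runs -/

namespace State

/-- The two states have the same registers and arrays below `d`. -/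
def Agree (d : ℕ) (s s' : State) : Prop := ∀ x < d, s.reg x = s'.reg x ∧ s.mem x = s'.mem x

theorem Agree.refl (d : ℕ) (s : State) : Agree d s s := fun _ _ => ⟨rfl, rfl⟩

theorem Agree.symm {d : ℕ} {s s' : State} (h : Agree d s s') : Agree d s' s :=
  fun x hx => ⟨(h x hx).1.symm, (h x hx).2.symm⟩

theorem Agree.trans {d : ℕ} {s s' s'' : State} (h : Agree d s s') (h' : Agree d s' s'') :
    Agree d s s'' :=
  fun x hx => ⟨(h x hx).1.trans (h' x hx).1, (h x hx).2.trans (h' x hx).2⟩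

theorem Agree.mono {d d' : ℕ} {s s' : State} (h : Agree d' s s') (hd : d ≤ d') : Agree d s s' :=
  fun x hx => h x (hx.trans_le hd)

@[simp] theorem setReg_reg (s : State) (x v y : ℕ) :
    (s.setReg x v).reg y = if y = x then v else s.reg y := by
  simp [setReg, Function.update_apply]

@[simp] theorem setReg_mem (s : State) (x v : ℕ) : (s.setReg x v).mem = s.mem := rfl

@[simp] theorem write_reg (s : State) (a n x : ℕ) (l : List Bool) :
    (s.write a n l).reg x = if x = n then l.length else s.reg x := by
  simp [write, Function.update_apply]

@[simp] theorem write_mem (s : State) (a n b : ℕ) (l : List Bool) :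
    (s.write a n l).mem b =
      if b = a then (fun i => if h : i < l.length then (l[i]'h).toNat else s.mem a i)
      else s.mem b := by
  simp [write, Function.update_apply]

/-- Replace the contents of array `a`. -/
def setArray (s : State) (a : ℕ) (f : ℕ → ℕ) : State := ⟨s.reg, Function.update s.mem a f⟩

@[simp] theorem setArray_reg (s : State) (a : ℕ) (f : ℕ → ℕ) : (s.setArray a f).reg = s.reg := rfl

@[simp] theorem setArray_mem (s : State) (a b : ℕ) (f : ℕ → ℕ) :
    (s.setArray a f).mem b = if b = a then f else s.mem b := by
  simp [setArray, Function.update_apply]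

@[simp] theorem setMem_reg (s : State) (a i v : ℕ) : (s.setMem a i v).reg = s.reg := rfl

@[simp] theorem setMem_mem (s : State) (a i v b : ℕ) : (s.setMem a i v).mem b =
    if b = a then (fun j => if j = i then v else s.mem a j) else s.mem b := by
  simp only [setMem, Function.update_apply]
  split
  · funext j
    simp [Function.update_apply]
  · rfl

theorem Agree.write {d : ℕ} {s s' : State} (h : Agree d s s') {a : ℕ} (ha : a < d) (n : ℕ)
    (l : List Bool) : Agree d (s.write a n l) (s'.write a n l) := by
  intro x hx
  refine ⟨?_, ?_⟩
  · simp only [write_reg, (h x hx).1]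
  · simp only [write_mem, (h x hx).2, (h a ha).2]

theorem holds_write (s : State) (a n : ℕ) (l : List Bool) : (s.write a n l).Holds a n l := by
  refine ⟨by simp, fun i hi => ?_⟩
  simp [hi]

theorem Holds.of_agree {d : ℕ} {s s' : State} (h : Agree d s s') {a n : ℕ} (ha : a < d)
    (hn : n < d) {l : List Bool} (hl : s'.Holds a n l) : s.Holds a n l := by
  refine ⟨(h n hn).1.trans hl.1, fun i hi => ?_⟩
  rw [(h a ha).2]
  exact hl.2 i hi

end State

/-- Arithmetic expressions over the registers and arrays. -/
inductive Expr where
  | const (n : ℕ)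
  | var (x : ℕ)
  | op (o : Op) (e e' : Expr)
  | load (a : ℕ) (e : Expr)

namespace Expr

/-- A program computing the expression into register `d`, using the registers from `d` on. -/
def code : Expr → ℕ → Prog
  | const n, d => .const d n
  | var x, d => .op .lor d x x
  | op o e e', d => .seq (e.code d) (.seq (e'.code (d + 1)) (.op o d d (d + 1)))
  | load a e, d => .seq (e.code d) (.load d a d)

def eval : Expr → State → ℕ
  | const n, _ => n
  | var x, s => s.reg x
  | op o e e', s => o.eval (e.eval s) (e'.eval s)
  | load a e, s => s.mem a (e.eval s)

def cost : Expr → ℕ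
  | const _ => 1
  | var _ => 1
  | op _ e e' => e.cost + (e'.cost + 1)
  | load _ e => e.cost + 1

/-- Only registers and arrays below `d` are used. -/
def Below (d : ℕ) : Expr → Prop
  | const _ => True
  | var x => x < d
  | op _ e e' => e.Below d ∧ e'.Below d
  | load a e => a < d ∧ e.Below d

/-- The words that occur in the evaluation are at most `W`. -/
def Fits (W : ℕ) (s : State) : Expr → Prop
  | const n => n ≤ W
  | var x => s.reg x ≤ W
  | op o e e' => e.Fits W s ∧ e'.Fits W s ∧ o.eval (e.eval s) (e'.eval s) ≤ W
  | load _ e => e.Fits W s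

variable {W : ℕ} {O : Oracle}

/-- The scratch bound `D` may exceed `d` because the second operand of an operation is evaluated
from `D + 1` on, while register `D` keeps the value of the first. -/
theorem exec {e : Expr} {d D : ℕ} {s s0 : State} (hb : e.Below d) (hd : d ≤ D) (hf : e.Fits W s)
    (h : s0.Agree d s) :
    ∃ s1, Exec W O (e.code D) s0 e.cost s1 ∧ s1.reg D = e.eval s ∧
      (∀ x < D, s1.reg x = s0.reg x) ∧ s1.mem = s0.mem := by
  induction e generalizing D s0 with
  | const n =>
    refine ⟨_, .const s0 D n hf, by simp [eval], fun x hx => ?_, rfl⟩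
    simp [hx.ne]
  | var x =>
    have hx := (h x hb).1
    -- A bitwise or of a register with itself serves as the copy instruction.
    refine ⟨_, .op s0 .lor D x x ?_, ?_, fun y hy => ?_, rfl⟩
    · simpa [Op.eval, hx, Fits] using hf
    · simp [eval, Op.eval, hx]
    · simp [hy.ne]
  | op o e e' ih ih' =>
    obtain ⟨s1, h1, v1, r1, m1⟩ := ih hb.1 hd hf.1 h
    have ha1 : s1.Agree d s := fun x hx =>
      ⟨(r1 x (hx.trans_le hd)).trans (h x hx).1, by rw [m1]; exact (h x hx).2⟩
    obtain ⟨s2, h2, v2, r2, m2⟩ := ih' hb.2 (hd.trans (Nat.le_succ D)) hf.2.1 ha1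
    have v1' : s2.reg D = e.eval s := (r2 D (Nat.lt_succ_self D)).trans v1
    refine ⟨_, .seq h1 (.seq h2 (.op s2 o D D (D + 1) ?_)), ?_, fun x hx => ?_, ?_⟩
    · rw [v1', v2]; exact hf.2.2
    · simp [v1', v2, eval]
    · simp [hx.ne, r2 x (hx.trans (Nat.lt_succ_self D)), r1 x hx]
    · simp [m2, m1]
  | load a e ih =>
    obtain ⟨s1, h1, v1, r1, m1⟩ := ih hb.2 hd hf h
    refine ⟨_, .seq h1 (.load s1 D a D), ?_, fun x hx => ?_, ?_⟩
    · simp [v1, m1, (h a hb.1).2, eval]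
    · simp [hx.ne, r1 x hx]
    · simp [m1]

theorem exec_agree {e : Expr} {d : ℕ} {s s0 : State} (hb : e.Below d) (hf : e.Fits W s)
    (h : s0.Agree d s) :
    ∃ s1, Exec W O (e.code d) s0 e.cost s1 ∧ s1.reg d = e.eval s ∧ s1.Agree d s := by
  obtain ⟨s1, h1, v1, r1, m1⟩ := exec hb le_rfl hf h
  exact ⟨s1, h1, v1, fun x hx => ⟨(r1 x hx).trans (h x hx).1, by rw [m1]; exact (h x hx).2⟩⟩

end Expr

/-- Up to the registers and arrays from `d` on, the program `p` leads from `s` to `s'` in at most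
`T` steps. -/
def Run (W : ℕ) (O : Oracle) (d : ℕ) (p : Prog) (s : State) (T : ℕ) (s' : State) : Prop :=
  ∀ s0, s0.Agree d s → ∃ t ≤ T, ∃ s1, s1.Agree d s' ∧ Exec W O p s0 t s1

/-- `x := e` -/
def assign (d x : ℕ) (e : Expr) : Prog := .seq (e.code d) (.op .lor x d d)

/-- `a[e] := e'` -/
def put (d a : ℕ) (e e' : Expr) : Prog :=
  .seq (e.code d) (.seq (e'.code (d + 1)) (.store a d (d + 1)))

/-- if `e` is nonzero then `p`, else `q` -/
def cond (d : ℕ) (e : Expr) (p q : Prog) : Prog := .seq (e.code d) (.branch d p q)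

/-- while `e` is nonzero do `p` -/
def while' (d : ℕ) (e : Expr) (p : Prog) : Prog :=
  .seq (e.code d) (.loop d (.seq p (e.code d)))

/-- for `d` from `0` below the contents of `x` do `p` -/
def upto (d x : ℕ) (p : Prog) : Prog :=
  .seq (.const d 0) (.seq (.op .lt (d + 1) d x) (.loop (d + 1)
    (.seq p (.seq (.const (d + 1) 1) (.seq (.op .add d d (d + 1)) (.op .lt (d + 1) d x))))))

section

variable {W : ℕ} {O : Oracle} {d : ℕ} {p q : Prog} {s s' s'' : State} {T T' : ℕ}

theorem Run.mono (h : Run W O d p s T s') (hT : T ≤ T') : Run W O d p s T' s' := fun s0 h0 => by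
  obtain ⟨t, ht, r⟩ := h s0 h0
  exact ⟨t, ht.trans hT, r⟩

theorem Run.congr (h : Run W O d p s T s') {r r' : State} (hr : r.Agree d s) (hr' : r'.Agree d s') :
    Run W O d p r T r' := fun s0 h0 => by
  obtain ⟨t, ht, s1, h1, e⟩ := h s0 (h0.trans hr)
  exact ⟨t, ht, s1, h1.trans hr'.symm, e⟩

/-- A state known up to `d` leaves the registers and arrays between `d` and `d'` open, whereas a run
at bound `d'` fixes them. Hence a run is required from every completion `r`, each with a final state
of its own. -/
theorem Run.lower {d' : ℕ} (hd : d ≤ d')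
    (h : ∀ r, r.Agree d s → ∃ r', r'.Agree d s' ∧ Run W O d' p r T r') :
    Run W O d p s T s' := fun s0 h0 => by
  obtain ⟨r', hr', H⟩ := h s0 h0
  obtain ⟨t, ht, s1, h1, e⟩ := H s0 (State.Agree.refl _ _)
  exact ⟨t, ht, s1, (h1.mono hd).trans hr', e⟩

theorem Run.seq (h : Run W O d p s T s') (h' : Run W O d q s' T' s'') :
    Run W O d (.seq p q) s (T + T') s'' := fun s0 h0 => by
  obtain ⟨t, ht, s1, h1, e1⟩ := h s0 h0
  obtain ⟨t', ht', s2, h2, e2⟩ := h' s1 h1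
  exact ⟨t + t', add_le_add ht ht', s2, h2, .seq e1 e2⟩

theorem Run.skip : Run W O d .skip s 1 s := fun s0 h0 => ⟨1, le_rfl, s0, h0, .skip s0⟩

theorem Run.assign {x : ℕ} {e : Expr} (hb : e.Below d) (hf : e.Fits W s)
    (hv : e.eval s ≤ W) :
    Run W O d (assign d x e) s (e.cost + 1) (s.setReg x (e.eval s)) := fun s0 h0 => by
  obtain ⟨s1, e1, v1, a1⟩ := Expr.exec_agree (O := O) hb hf h0
  refine ⟨_, le_rfl, _, ?_, .seq e1 (.op s1 .lor x d d (by simpa [Op.eval, v1] using hv))⟩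
  intro y hy
  refine ⟨?_, (a1 y hy).2⟩
  simp [Op.eval, v1, (a1 y hy).1]

theorem Run.put {a : ℕ} {e e' : Expr} (hb : e.Below d) (hb' : e'.Below d)
    (hf : e.Fits W s) (hf' : e'.Fits W s) :
    Run W O d (put d a e e') s (e.cost + (e'.cost + 1)) (s.setMem a (e.eval s) (e'.eval s)) :=
  fun s0 h0 => by
  obtain ⟨s1, e1, v1, a1⟩ := Expr.exec_agree (O := O) hb hf h0
  obtain ⟨s2, e2, v2, r2, m2⟩ := Expr.exec (O := O) (D := d + 1) hb' (Nat.le_succ d) hf' a1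
  refine ⟨_, le_rfl, _, ?_, .seq e1 (.seq e2 (.store s2 a d (d + 1)))⟩
  intro y hy
  refine ⟨(r2 y (hy.trans (Nat.lt_succ_self d))).trans (a1 y hy).1, ?_⟩
  simp only [State.setMem, r2 d (Nat.lt_succ_self d), v1, v2, m2]
  by_cases hya : y = a
  · subst hya
    simp [(a1 y hy).2]
  · simp [hya, (a1 y hy).2]

theorem Run.cond {e : Expr} (hb : e.Below d) (hf : e.Fits W s)
    (h : e.eval s ≠ 0 → Run W O d p s T s') (h' : e.eval s = 0 → Run W O d q s T s') :
    Run W O d (cond d e p q) s (e.cost + (T + 1)) s' := fun s0 h0 => by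
  obtain ⟨s1, e1, v1, a1⟩ := Expr.exec_agree (O := O) hb hf h0
  by_cases hv : e.eval s = 0
  · obtain ⟨t, ht, s2, a2, e2⟩ := h' hv s1 a1
    exact ⟨_, by omega, s2, a2, .seq e1 (.branch_false (by rw [v1, hv]) e2)⟩
  · obtain ⟨t, ht, s2, a2, e2⟩ := h hv s1 a1
    exact ⟨_, by omega, s2, a2, .seq e1 (.branch_true (by rwa [v1]) e2)⟩

theorem Run.while' {e : Expr} {σ : ℕ → State} {n : ℕ} (hb : e.Below d)
    (hf : ∀ j ≤ n, e.Fits W (σ j)) (hlt : ∀ j < n, e.eval (σ j) ≠ 0) (hn : e.eval (σ n) = 0)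
    (h : ∀ j < n, Run W O d p (σ j) T (σ (j + 1))) :
    Run W O d (while' d e p) (σ 0) (n * (T + e.cost + 1) + e.cost + 1) (σ n) := by
  have key : ∀ m j, j + m = n → ∀ s1 : State, s1.Agree d (σ j) → s1.reg d = e.eval (σ j) →
      ∃ t ≤ m * (T + e.cost + 1) + 1, ∃ s2, s2.Agree d (σ n) ∧
        Exec W O (.loop d (.seq p (e.code d))) s1 t s2 := by
    intro m
    induction m with
    | zero =>
      intro j hj s1 a1 v1
      obtain rfl : j = n := by omega
      exact ⟨1, by omega, s1, a1, .loop_false (by rw [v1, hn])⟩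
    | succ m ih =>
      intro j hj s1 a1 v1
      obtain ⟨t, ht, s2, a2, e2⟩ := h j (by omega) s1 a1
      obtain ⟨s3, e3, v3, a3⟩ := Expr.exec_agree (O := O) hb (hf (j + 1) (by omega)) a2
      obtain ⟨t', ht', s4, a4, e4⟩ := ih (j + 1) (by omega) s3 a3 v3
      refine ⟨_, ?_, s4, a4, .loop_true (by rw [v1]; exact hlt j (by omega)) (.seq e2 e3) e4⟩
      rw [Nat.succ_mul]
      omega
  intro s0 h0
  obtain ⟨s1, e1, v1, a1⟩ := Expr.exec_agree (O := O) hb (hf 0 (Nat.zero_le _)) h0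
  obtain ⟨t, ht, s2, a2, e2⟩ := key n 0 (by omega) s1 a1 v1
  exact ⟨_, by omega, s2, a2, .seq e1 e2⟩

/-- The counter occupies register `d`, so the body runs at bound `d + 1`, while `σ` describes only
what lies below `d`. The body may destroy the flag in register `d + 1`, which is recomputed from the
counter after each turn; this and the loop step account for the `4`. -/
theorem Run.upto {x n : ℕ} {σ : ℕ → State} (hx : x < d) (hn : n ≤ W) (hW : 1 ≤ W)
    (hσ : ∀ j ≤ n, (σ j).reg x = n)
    (h : ∀ j < n, ∀ s, s.Agree d (σ j) → s.reg d = j →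
      ∃ s', s'.Agree d (σ (j + 1)) ∧ s'.reg d = j ∧ Run W O (d + 1) p s T s') :
    Run W O d (upto d x p) (σ 0) (n * (T + 4) + 3) (σ n) := by
  have key : ∀ m j, j + m = n → ∀ s1 : State, s1.Agree d (σ j) → s1.reg d = j →
      s1.reg (d + 1) = Op.lt.eval j n →
      ∃ t ≤ m * (T + 4) + 1, ∃ s2, s2.Agree d (σ n) ∧
        Exec W O (.loop (d + 1) (.seq p (.seq (.const (d + 1) 1)
          (.seq (.op .add d d (d + 1)) (.op .lt (d + 1) d x))))) s1 t s2 := by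
    intro m
    induction m with
    | zero =>
      intro j hj s1 a1 v1 w1
      obtain rfl : j = n := by omega
      exact ⟨1, by omega, s1, a1, .loop_false (by rw [w1]; simp [Op.eval])⟩
    | succ m ih =>
      intro j hj s1 a1 v1 w1
      have hjn : j < n := by omega
      obtain ⟨s', as', vs', H⟩ := h j hjn s1 a1 v1
      obtain ⟨t, ht, s2, a2, e2⟩ := H s1 (State.Agree.refl _ _)
      have v2 : s2.reg d = j := (a2 d (Nat.lt_succ_self d)).1.trans vs'
      have a2' : s2.Agree d (σ (j + 1)) := (a2.mono (Nat.le_succ d)).trans as'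
      have vx : s2.reg x = n := (a2' x hx).1.trans (hσ _ hjn)
      let s3 := s2.setReg (d + 1) 1
      let s4 := s3.setReg d (Op.add.eval (s3.reg d) (s3.reg (d + 1)))
      let s5 := s4.setReg (d + 1) (Op.lt.eval (s4.reg d) (s4.reg x))
      have r3 : s4.reg d = j + 1 := by simp [s4, s3, Op.eval, v2]
      have x4 : s4.reg x = n := by
        have h1 : x ≠ d := hx.ne
        have h2 : x ≠ d + 1 := by omega
        simp [s4, s3, h1, h2, vx]
      have e3 : Exec W O (.seq (.const (d + 1) 1)
          (.seq (.op .add d d (d + 1)) (.op .lt (d + 1) d x))) s2 (1 + (1 + 1)) s5 := by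
        refine .seq (.const _ _ _ hW) (.seq (.op _ _ _ _ _ ?_) (.op _ _ _ _ _ ?_))
        · simp only [Op.eval]
          simp [v2]; omega
        · change Op.lt.eval (s4.reg d) (s4.reg x) ≤ W
          simp only [Op.eval]
          split <;> omega
      obtain ⟨t', ht', s6, a6, e6⟩ := ih (j + 1) (by omega) s5 (by
        intro y hy
        refine ⟨?_, (a2' y hy).2⟩
        have h1 : y ≠ d := hy.ne
        have h2 : y ≠ d + 1 := by omega
        simp [s5, s4, s3, h1, h2, (a2' y hy).1]) (by simp [s5, r3]) (by simp [s5, r3, x4])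
      refine ⟨_, ?_, s6, a6, .loop_true (by rw [w1]; simp [Op.eval, hjn]) (.seq e2 e3) e6⟩
      rw [Nat.succ_mul]
      omega
  intro s0 h0
  have vx : s0.reg x = n := (h0 x hx).1.trans (hσ 0 (Nat.zero_le _))
  let s1 := s0.setReg d 0
  let s2 := s1.setReg (d + 1) (Op.lt.eval (s1.reg d) (s1.reg x))
  have x1 : s1.reg x = n := by simp [s1, hx.ne, vx]
  have d1 : s1.reg d = 0 := by simp [s1]
  obtain ⟨t, ht, s3, a3, e3⟩ := key n 0 (by omega) s2 (by
    intro y hy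
    have h1 : y ≠ d := hy.ne
    have h2 : y ≠ d + 1 := by omega
    refine ⟨?_, (h0 y hy).2⟩
    simp [s2, s1, h1, h2, (h0 y hy).1]) (by simp [s2, d1]) (by simp [s2, d1, x1])
  refine ⟨_, ?_, s3, a3, .seq (.const _ _ _ (Nat.zero_le _)) (.seq (.op _ _ _ _ _ ?_) e3)⟩
  · omega
  · change Op.lt.eval (s1.reg d) (s1.reg x) ≤ W
    simp only [Op.eval]
    split <;> omega

theorem Run.query {a b : ℕ} (ha : a < d) (hb : b < d) {u v : List Bool}
    (hu : s.Holds a a u) (hr : O u v) (h : v.length ≤ W) :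
    Run W O d (.query a a b b) s (u.length + v.length + 1) (s.write b b v) := fun s0 h0 =>
  ⟨_, le_rfl, _, h0.write hb b v, .query s0 a a b b u v (hu.of_agree h0 ha ha) hr h⟩

end

/-! ## Programs that append bits to an array -/

/-- Up to the registers and arrays from `d` on, the only effect of `p` is to append `l` to array
`A`, whose length is kept in register `A`. -/
def Emits (W : ℕ) (O : Oracle) (A d : ℕ) (p : Prog) (s : State) (T : ℕ) (l : List Bool) : Prop :=
  ∀ l0 : List Bool, l0.length + l.length ≤ W →
    Run W O d p (s.write A A l0) T (s.write A A (l0 ++ l))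

/-- Append the value of `e` to array `A`. -/
def emit (A d : ℕ) (e : Expr) : Prog :=
  .seq (put d A (.var A) e) (assign d A (.op .add (.var A) (.const 1)))

section

variable {W : ℕ} {O : Oracle} {A d : ℕ} {p q : Prog} {s : State} {T T' : ℕ} {l l' : List Bool}

theorem Emits.mono (h : Emits W O A d p s T l) (hT : T ≤ T') : Emits W O A d p s T' l :=
  fun l0 h0 => (h l0 h0).mono hT

/-- The quantification over the prefix in `Emits` makes this work: the second program is run with
prefix `l0 ++ l`. -/
theorem Emits.seq (h : Emits W O A d p s T l) (h' : Emits W O A d q s T' l') :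
    Emits W O A d (.seq p q) s (T + T') (l ++ l') := fun l0 h0 => by
  rw [List.length_append] at h0
  have := h' (l0 ++ l) (by rw [List.length_append]; omega)
  rw [List.append_assoc] at this
  exact (h l0 (by omega)).seq this

theorem Emits.emit {e : Expr} {b : Bool} (hA : A < d) (hb : e.Below d)
    (h : ∀ l0, l0.length < W → e.Fits W (s.write A A l0) ∧ e.eval (s.write A A l0) = b.toNat) :
    Emits W O A d (emit A d e) s (e.cost + 6) [b] := fun l0 h0 => by
  have h0' : l0.length < W := by simpa using h0
  obtain ⟨hf, hv⟩ := h l0 h0'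
  refine ((Run.put (a := A) (e := .var A) (e' := e) hA hb ?_ hf).seq
    (Run.assign (x := A) (e := .op .add (.var A) (.const 1)) ⟨hA, trivial⟩ ?_ ?_)).mono
      (T := Expr.cost (.var A) + (e.cost + 1) + (Expr.cost (.op .add (.var A) (.const 1)) + 1)) ?_
    |>.congr (State.Agree.refl _ _) ?_
  · simp [Expr.Fits]; omega
  · simp [Expr.Fits, Expr.eval, Op.eval, State.setMem]; omega
  · simp [Expr.eval, Op.eval, State.setMem]; omega
  · simp only [Expr.cost]; omega
  · intro x hx
    refine ⟨?_, ?_⟩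
    · simp only [State.write_reg, State.setReg_reg, Expr.eval, Op.eval, State.setMem]
      split <;> simp
    · by_cases hxA : x = A
      · subst hxA
        funext i
        simp only [State.write_mem, State.setReg_mem, Expr.eval, State.setMem, hv,
          State.write_reg, Function.update_apply, if_true, List.length_append,
          List.length_singleton]
        rcases lt_trichotomy i l0.length with hi | hi | hi
        · rw [dif_pos (by omega), if_neg (by omega), dif_pos hi, List.getElem_append_left hi]
        · subst hi
          simp
        · rw [dif_neg (by omega), if_neg (by omega), dif_neg (by omega)]
      · simp [hxA, State.setMem]

theorem Emits.cond {e : Expr} {P : Prop} [Decidable P] (hb : e.Below d)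
    (h : ∀ l0, l0.length ≤ W → e.Fits W (s.write A A l0) ∧ (e.eval (s.write A A l0) ≠ 0 ↔ P))
    (hp : P → Emits W O A d p s T l) (hq : ¬ P → Emits W O A d q s T l') :
    Emits W O A d (cond d e p q) s (e.cost + (T + 1)) (if P then l else l') := fun l0 h0 => by
  obtain ⟨hf, hv⟩ := h l0 (by omega)
  refine Run.cond hb hf (fun h1 => ?_) (fun h1 => ?_)
  · have hP := hv.1 h1
    rw [if_pos hP] at h0 ⊢
    exact hp hP l0 h0
  · have hP : ¬ P := fun hP => hv.2 hP h1
    rw [if_neg hP] at h0 ⊢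
    exact hq hP l0 h0

theorem Emits.skip : Emits W O A d .skip s 1 [] := fun l0 _ s0 h0 =>
  ⟨1, le_rfl, s0, by simpa using h0, .skip s0⟩

theorem Emits.upto {x n : ℕ} {F : ℕ → List Bool} (hA : A < d) (hx : x < d) (hxA : x ≠ A)
    (hn : n ≤ W) (hW : 1 ≤ W) (hs : s.reg x = n)
    (h : ∀ j < n, ∀ s', s'.Agree d s → s'.reg d = j → Emits W O A (d + 1) p s' T (F j)) :
    Emits W O A d (upto d x p) s (n * (T + 4) + 3) ((List.range n).flatMap F) := fun l0 h0 => by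
  have key := Run.upto (W := W) (O := O) (p := p) (T := T) (d := d)
    (σ := fun j => s.write A A (l0 ++ (List.range j).flatMap F)) hx hn hW
    (fun j _ => by simp [hxA, hs]) ?_
  · simpa using key
  intro j hj s1 a1 v1
  have hlen : ((List.range j).flatMap F).length + (F j).length ≤
      ((List.range n).flatMap F).length := by
    have : ((List.range (j + 1)).flatMap F).length ≤ ((List.range n).flatMap F).length :=
      ((List.range_sublist.2 (by omega : j + 1 ≤ n)).flatMap F).length_le
    simpa [List.range_succ] using this
  -- The hypothesis on the body concerns states that agree with `s` also in array `A`. So `A` is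
  -- reset to its contents in `s`, and the bits emitted in earlier turns become part of the prefix.
  let s' : State := ⟨Function.update s1.reg A (s.reg A), Function.update s1.mem A (s.mem A)⟩
  have as' : s'.Agree d s := by
    intro y hy
    have := a1 y hy
    by_cases hyA : y = A
    · subst hyA; simp [s']
    · simpa [s', hyA] using this
  have vs' : s'.reg d = j := by simpa [s', hA.ne'] using v1
  have H := h j hj s' as' vs' (l0 ++ (List.range j).flatMap F)
    (by rw [List.length_append]; omega)
  refine ⟨s'.write A A (l0 ++ (List.range (j + 1)).flatMap F), as'.write hA A _,
    by simp [hA.ne', vs'], ?_⟩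
  refine H.congr ?_ ?_
  · intro y hy
    by_cases hyA : y = A
    · subst hyA
      refine ⟨by rw [(a1 y hA).1]; simp, ?_⟩
      rw [(a1 y hA).2]; simp [s']
    · simp [s', hyA]
  · simp [List.range_succ, State.Agree.refl]

end

/-! ## Reading the input -/

/-- Array `a` contains the bits `l` from position `p` on. -/
def State.Stores (s : State) (a p : ℕ) (l : List Bool) : Prop :=
  ∀ (i : ℕ) (h : i < l.length), s.mem a (p + i) = (l[i]'h).toNat

theorem State.stores_init (l : List Bool) : (State.init l).Stores 0 0 l := fun i hi => by
  simp [State.init, hi]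

theorem length_unaryThen (n : ℕ) (l : List Bool) :
    (unaryThen n l).length = n + 1 + l.length := by
  simp [unaryThen]; omega

section

variable {s : State} {a p n : ℕ} {l : List Bool}

theorem State.Stores.unary_lt (h : s.Stores a p (unaryThen n l)) {i : ℕ} (hi : i < n) :
    s.mem a (p + i) = 1 := by
  rw [h i (by rw [length_unaryThen]; omega)]
  simp [unaryThen, hi]

theorem State.Stores.unary_eq (h : s.Stores a p (unaryThen n l)) : s.mem a (p + n) = 0 := by
  rw [h n (by rw [length_unaryThen]; omega)]
  simp [unaryThen]

theorem State.Stores.unary_rest (h : s.Stores a p (unaryThen n l)) :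
    s.Stores a (p + n + 1) l := fun i hi => by
  rw [show p + n + 1 + i = p + (n + 1 + i) by ring, h (n + 1 + i) (by rw [length_unaryThen]; omega)]
  simp only [unaryThen]
  rw [List.getElem_append_right (by simp; omega)]
  simp [show n + 1 + i - n = i + 1 by omega]

theorem State.Stores.of_mem_eq (h : s.Stores a p l) {s' : State} (hs : s'.mem a = s.mem a) :
    s'.Stores a p l := fun i hi => by rw [hs, h i hi]

end

/-- Read a unary number at position `pos` of array `0` into register `cnt`, and move `pos`
behind it. -/
def readUnary (d pos cnt : ℕ) : Prog :=
  .seq (while' d (.load 0 (.var pos))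
    (.seq (assign d cnt (.op .add (.var cnt) (.const 1)))
      (assign d pos (.op .add (.var pos) (.const 1)))))
    (assign d pos (.op .add (.var pos) (.const 1)))

/-- The bit at `pos` is itself the loop guard, so the loop stops at the separator and the last
assignment skips it. A turn takes 11 steps: two assignments of four, two for the guard and one for
the loop. -/
theorem run_readUnary {W : ℕ} {O : Oracle} {d pos cnt p n : ℕ} {s : State} {l : List Bool}
    (hpos : pos < d) (hcnt : cnt < d) (hne : pos ≠ cnt) (hp : s.reg pos = p) (hc : s.reg cnt = 0)
    (hs : s.Stores 0 p (unaryThen n l)) (hW : p + n + 1 ≤ W) :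
    Run W O d (readUnary d pos cnt) s (n * 11 + 7)
      ((s.setReg cnt n).setReg pos (p + n + 1)) := by
  have h0 : 0 < d := by omega
  have hne' := hne.symm
  have key := Run.while' (W := W) (O := O) (d := d) (T := 8) (e := .load 0 (.var pos))
    (p := .seq (assign d cnt (.op .add (.var cnt) (.const 1)))
      (assign d pos (.op .add (.var pos) (.const 1))))
    (σ := fun j => (s.setReg cnt j).setReg pos (p + j)) (n := n) ⟨h0, hpos⟩
    (fun j hj => by simp [Expr.Fits]; omega)
    (fun j hj => by simp [Expr.eval, hs.unary_lt hj])
    (by simp [Expr.eval, hs.unary_eq]) (fun j hj => ?_)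
  · refine Run.mono (Run.congr (Run.seq key (Run.assign (x := pos) (d := d)
      (e := .op .add (.var pos) (.const 1)) ⟨hpos, trivial⟩ ?_ ?_)) ?_ ?_) ?_
    · simp [Expr.Fits, Expr.eval, Op.eval]; omega
    · simp [Expr.eval, Op.eval]; omega
    · intro x hx
      by_cases h1 : x = pos <;> by_cases h2 : x = cnt <;> simp_all
    · intro x hx
      by_cases h1 : x = pos <;> by_cases h2 : x = cnt <;> simp_all [Expr.eval, Op.eval]
    · simp only [Expr.cost]; omega
  · refine Run.mono (Run.congr (Run.seq (Run.assign (x := cnt)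
      (e := .op .add (.var cnt) (.const 1)) ⟨hcnt, trivial⟩ ?_ ?_) (Run.assign (x := pos)
      (e := .op .add (.var pos) (.const 1)) ⟨hpos, trivial⟩ ?_ ?_))
      (State.Agree.refl _ _) ?_) ?_
    · simp [Expr.Fits, Expr.eval, Op.eval, hne']; omega
    · simp [Expr.eval, Op.eval, hne']; omega
    · simp [Expr.Fits, Expr.eval, Op.eval, hne]; omega
    · simp [Expr.eval, Op.eval, hne]; omega
    · intro x hx
      by_cases h1 : x = pos <;> by_cases h2 : x = cnt <;>
        simp_all [Expr.eval, Op.eval, add_assoc]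
    · simp only [Expr.cost]; omega

theorem emits_ones {W : ℕ} {O : Oracle} {A d x n : ℕ} {s : State} (hA : A < d) (hx : x < d)
    (hxA : x ≠ A) (hn : n ≤ W) (hW : 1 ≤ W) (hs : s.reg x = n) :
    Emits W O A d (upto d x (emit A (d + 1) (.const 1))) s (n * 11 + 3)
      (List.replicate n true) := by
  have := Emits.upto (W := W) (O := O) (A := A) (d := d) (x := x) (n := n) (s := s) (T := 7)
    (p := emit A (d + 1) (.const 1)) (F := fun _ => [true]) hA hx hxA hn hW hs
    (fun j hj s' _ _ => Emits.emit (by omega) trivial fun l0 _ => ⟨hW, rfl⟩)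
  have e : ∀ n, (List.range n).flatMap (fun _ => [true]) = List.replicate n true := fun n => by
    induction n with
    | zero => rfl
    | succ n ih => simp [List.range_succ, ih, List.replicate_succ']
  rwa [e] at this

theorem emits_bit {W : ℕ} {O : Oracle} {A d : ℕ} {s : State} (hA : A < d) (hW : 1 ≤ W) (b : Bool) :
    Emits W O A d (emit A d (.const b.toNat)) s 7 [b] :=
  Emits.emit hA trivial fun _ _ => ⟨b.toNat_le.trans hW, rfl⟩

/-! ## Adjacency matrices -/

open Classical in
-- This passes from matrix entries indexed by positions to nested lists over arbitrary vertex
-- labels, the form in which nested loops emit a matrix.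
theorem matrixBits_eq_flatMap {α β : Type*} {a b : ℕ} {r : Fin a → Fin b → Prop} {L : List α}
    {R : List β} (hL : L.length = a) (hR : R.length = b) (P : α → β → Prop)
    (h : ∀ (u : Fin a) (v : Fin b), r u v ↔ P L[u] R[v]) :
    matrixBits r = L.flatMap fun x => R.map fun y => decide (P x y) := by
  subst hL hR
  have e1 : (L.flatMap fun x => R.map fun y => decide (P x y)) =
      (List.ofFn fun u : Fin L.length => List.ofFn fun v : Fin R.length =>
        decide (P L[u] R[v])).flatten := by
    rw [List.flatMap_def]
    congr 1
    conv_lhs => rw [← List.ofFn_get L, List.map_ofFn]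
    congr 1
    funext u
    simp only [Function.comp]
    conv_lhs => rw [← List.ofFn_get R, List.map_ofFn]
    rfl
  rw [e1, matrixBits, List.ofFn_mul]
  congr 1
  congr 1
  funext u
  congr 1
  funext v
  have e2 : finProdFinEquiv.symm (⟨u * R.length + v, by
      calc (u : ℕ) * R.length + v < (u + 1) * R.length := by have := v.2; linarith
        _ ≤ _ := Nat.mul_le_mul_right _ u.2⟩ : Fin (L.length * R.length)) = (u, v) := by
    rw [Equiv.symm_apply_eq]
    ext
    simp [finProdFinEquiv]
    ring
  rw [e2]
  simp only [h]

theorem length_matrixBits {a b : ℕ} (r : Fin a → Fin b → Prop) :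
    (matrixBits r).length = a * b := by simp [matrixBits]

open Classical in
theorem matrixBits_getElem {a b : ℕ} (r : Fin a → Fin b → Prop) {u v : ℕ} (hu : u < a)
    (hv : v < b) (h : u * b + v < (matrixBits r).length) :
    (matrixBits r)[u * b + v] = decide (r ⟨u, hu⟩ ⟨v, hv⟩) := by
  have e2 : finProdFinEquiv.symm (⟨u * b + v, by rwa [length_matrixBits] at h⟩ : Fin (a * b)) =
      (⟨u, hu⟩, ⟨v, hv⟩) := by
    rw [Equiv.symm_apply_eq]
    ext
    simp [finProdFinEquiv]
    ring
  simp only [matrixBits, List.getElem_ofFn]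
  rw [e2]

theorem mul_add_lt_mul {u v a b : ℕ} (hu : u < a) (hv : v < b) : u * b + v < a * b :=
  calc u * b + v < (u + 1) * b := by linarith
    _ ≤ _ := Nat.mul_le_mul_right _ hu

open Classical in
theorem State.Stores.matrix {s : State} {A p a b : ℕ} {r : Fin a → Fin b → Prop}
    (h : s.Stores A p (matrixBits r)) {u v : ℕ} (hu : u < a) (hv : v < b) :
    s.mem A (p + (u * b + v)) = (decide (r ⟨u, hu⟩ ⟨v, hv⟩)).toNat := by
  have h1 : u * b + v < (matrixBits r).length := by
    rw [length_matrixBits]; exact mul_add_lt_mul hu hv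
  rw [h _ h1, matrixBits_getElem r hu hv h1]

end WordRAM

open WordRAM

/-! ## Membership: independent sets are cliques of the complement -/

namespace WordRAM

/-- With `a`, `b`, `k` in registers `3`, `4`, `5` and the matrix of a relation at position
register `2` of array `0`, emit the complement of the bipartite graph, and `k`. -/
def complementProg : Prog :=
  .seq (upto 6 3 (emit 1 7 (.const 1))) (.seq (upto 6 4 (emit 1 7 (.const 1)))
    (.seq (emit 1 6 (.const 0)) (.seq (upto 6 5 (emit 1 7 (.const 1)))
      (.seq (emit 1 6 (.const 0)) (.seq
        (upto 6 3 (.seq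
          (upto 7 3 (emit 1 8 (.op .sub (.const 1) (.op .eq (.var 6) (.var 7)))))
          (upto 7 4 (emit 1 8 (.op .sub (.const 1) (.load 0 (.op .add (.var 2)
            (.op .add (.op .mul (.var 6) (.var 4)) (.var 7)))))))))
        (upto 6 4 (.seq
          (upto 7 3 (emit 1 8 (.op .sub (.const 1) (.load 0 (.op .add (.var 2)
            (.op .add (.op .mul (.var 7) (.var 4)) (.var 6)))))))
          (upto 7 4 (emit 1 8 (.op .sub (.const 1) (.op .eq (.var 6) (.var 7))))))))))))

/-- Emit the graph with one vertex, and the number `1`. -/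
def trivialCliqueProg : Prog :=
  .seq (emit 1 6 (.const 1)) (.seq (emit 1 6 (.const 0)) (.seq (emit 1 6 (.const 1))
    (.seq (emit 1 6 (.const 0)) (emit 1 6 (.const 0)))))

/-- The reduction from independent sets in bipartite graphs to cliques. -/
def complementReduction : Prog :=
  .seq (.seq (assign 6 1 (.const 0)) (.seq (readUnary 6 2 3)
    (.seq (readUnary 6 2 4) (readUnary 6 2 5))))
    (cond 6 (.var 5) complementProg trivialCliqueProg)

/-- Adjacency in the complement of the bipartite graph with edges `E`. -/
def CoAdj (E : ℕ → ℕ → Prop) : ℕ ⊕ ℕ → ℕ ⊕ ℕ → Prop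
  | .inl x, .inl y => x ≠ y
  | .inl x, .inr y => ¬ E x y
  | .inr x, .inl y => ¬ E y x
  | .inr x, .inr y => x ≠ y

/-- The vertices of a bipartite graph. -/
def bipartiteVertices (a b : ℕ) : List (ℕ ⊕ ℕ) :=
  (List.range a).map .inl ++ (List.range b).map .inr

open Classical in
theorem emits_complementProg {W : ℕ} {O : Oracle} {s : State} {a b k p : ℕ} {E : ℕ → ℕ → Prop}
    (ha : s.reg 3 = a) (hb : s.reg 4 = b) (hk : s.reg 5 = k) (hp : s.reg 2 = p)
    (hE : ∀ u < a, ∀ v < b, s.mem 0 (p + (u * b + v)) = (decide (E u v)).toNat)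
    (hW : 1 ≤ W) (haW : a ≤ W) (hbW : b ≤ W) (hkW : k ≤ W) (hpW : p + a * b ≤ W) :
    Emits W O 1 6 complementProg s
      (11 * (a + b + k) + 30 + (a + b) * (34 * (a + b) + 10))
      (unaryThen (a + b) (unaryThen k ((bipartiteVertices a b).flatMap fun x =>
        (bipartiteVertices a b).map fun y => decide (CoAdj E x y)))) := by
  -- Two kinds of blocks occur in the complement: within one side distinct vertices are adjacent
  -- (`hne`), and across the sides the input bit is negated (`hed`), read at the same position for
  -- both orders of the two vertices.
  have hne : ∀ (P : Prop) (s' : State) (x y : ℕ), (P ↔ x ≠ y) → s'.reg 6 = x →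
      s'.reg 7 = y → x ≤ W → y ≤ W →
      Emits W O 1 8 (emit 1 8 (.op .sub (.const 1) (.op .eq (.var 6) (.var 7)))) s' 30
        [decide P] := by
    intro P s' x y hP hx hy hxW hyW
    refine (Emits.emit (by omega) (by simp [Expr.Below]) fun l0 _ => ?_).mono
      (by simp only [Expr.cost]; omega)
    by_cases hxy : x = y
    · simp [Expr.Fits, Expr.eval, Op.eval, hx, hy, hxy, hW, hyW, hP]
    · simp [Expr.Fits, Expr.eval, Op.eval, hx, hy, hxy, hW, hxW, hyW, hP]
  have hed : ∀ (P : Prop) (s' : State) (i j u v : ℕ), (P ↔ ¬ E u v) → i < 8 → j < 8 →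
      i ≠ 1 → j ≠ 1 →
      s'.reg i = u → s'.reg j = v → u < a → v < b →
      s'.Agree 6 s →
      Emits W O 1 8 (emit 1 8 (.op .sub (.const 1) (.load 0 (.op .add (.var 2)
            (.op .add (.op .mul (.var i) (.var 4)) (.var j)))))) s' 30
        [decide P] := by
    intro P s' i j u v hP hi hj hi1 hj1 hx hy hu hv hs
    have h2 := (hs 2 (by omega)).1.trans hp
    have h4 := (hs 4 (by omega)).1.trans hb
    have h0 := (hs 0 (by omega)).2
    have hm := mul_add_lt_mul hu hv
    refine (Emits.emit (by omega) (by simp [Expr.Below, hi, hj]) fun l0 _ => ?_).mono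
      (by simp only [Expr.cost]; omega)
    refine ⟨?_, ?_⟩
    · simp [Expr.Fits, Expr.eval, Op.eval, hx, hy, h2, h4, hi1, hj1]
      refine ⟨hW, ⟨?_, ⟨⟨?_, ?_, ?_⟩, ?_, ?_⟩, ?_⟩, ?_⟩ <;> omega
    · simp [Expr.eval, Op.eval, hx, hy, h2, h4, hi1, hj1, h0, hE u hu v hv]
      by_cases hh : E u v <;> simp [hh, hP]
  have main := (emits_ones (O := O) (A := 1) (d := 6) (x := 3) (by omega) (by omega) (by omega)
      haW hW ha).seq <| (emits_ones (O := O) (A := 1) (d := 6) (x := 4) (by omega) (by omega)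
      (by omega) hbW hW hb).seq <| (emits_bit (O := O) (A := 1) (d := 6) (s := s) (by omega)
      hW false).seq <| (emits_ones (O := O) (A := 1) (d := 6) (x := 5) (by omega) (by omega)
      (by omega) hkW hW hk).seq <| (emits_bit (O := O) (A := 1) (d := 6) (s := s) (by omega)
      hW false).seq <|
    (Emits.upto (O := O) (A := 1) (d := 6) (x := 3) (s := s) (by omega) (by omega) (by omega)
      haW hW ha fun x hx s1 a1 v1 =>
      (Emits.upto (O := O) (A := 1) (d := 7) (x := 3) (s := s1) (by omega) (by omega) (by omega)
        haW hW ((a1 3 (by omega)).1.trans ha) fun y hy s2 a2 v2 =>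
        hne (CoAdj E (.inl x) (.inl y)) s2 x y Iff.rfl ((a2 6 (by omega)).1.trans v1) v2
          (by omega) (by omega)).seq
      (Emits.upto (O := O) (A := 1) (d := 7) (x := 4) (s := s1) (by omega) (by omega) (by omega)
        hbW hW ((a1 4 (by omega)).1.trans hb) fun y hy s2 a2 v2 =>
        hed (CoAdj E (.inl x) (.inr y)) s2 6 7 x y Iff.rfl (by omega) (by omega)
          (by omega) (by omega)
          ((a2 6 (by omega)).1.trans v1) v2 (by omega) (by omega)
          ((a2.mono (by omega)).trans a1))).seq
    (Emits.upto (O := O) (A := 1) (d := 6) (x := 4) (s := s) (by omega) (by omega) (by omega)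
      hbW hW hb fun x hx s1 a1 v1 =>
      (Emits.upto (O := O) (A := 1) (d := 7) (x := 3) (s := s1) (by omega) (by omega) (by omega)
        haW hW ((a1 3 (by omega)).1.trans ha) fun y hy s2 a2 v2 =>
        hed (CoAdj E (.inr x) (.inl y)) s2 7 6 y x Iff.rfl (by omega) (by omega)
          (by omega) (by omega)
          v2 ((a2 6 (by omega)).1.trans v1) (by omega) (by omega)
          ((a2.mono (by omega)).trans a1)).seq
      (Emits.upto (O := O) (A := 1) (d := 7) (x := 4) (s := s1) (by omega) (by omega) (by omega)
        hbW hW ((a1 4 (by omega)).1.trans hb) fun y hy s2 a2 v2 =>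
        hne (CoAdj E (.inr x) (.inr y)) s2 x y Iff.rfl ((a2 6 (by omega)).1.trans v1) v2
          (by omega) (by omega)))
  -- The `a` ones and the `b` ones together are `a + b` in unary, so the sum is never computed.
  have hl : unaryThen (a + b) (unaryThen k ((bipartiteVertices a b).flatMap fun x =>
        (bipartiteVertices a b).map fun y => decide (CoAdj E x y))) =
      List.replicate a true ++ (List.replicate b true ++ ([false] ++ (List.replicate k true ++
      ([false] ++ ((List.range a).flatMap (fun x =>
        (List.range a).flatMap (fun y => [decide (CoAdj E (.inl x) (.inl y))]) ++
        (List.range b).flatMap (fun y => [decide (CoAdj E (.inl x) (.inr y))])) ++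
      (List.range b).flatMap (fun x =>
        (List.range a).flatMap (fun y => [decide (CoAdj E (.inr x) (.inl y))]) ++
        (List.range b).flatMap (fun y => [decide (CoAdj E (.inr x) (.inr y))]))))))) := by
    simp only [unaryThen, List.replicate_add, List.append_assoc, List.singleton_append,
      bipartiteVertices, List.flatMap_append, List.flatMap_map, List.map_append, List.map_map,
      ← List.map_eq_flatMap]
    rfl
  rw [hl]
  refine Emits.mono main ?_
  ring_nf
  nlinarith

theorem emits_trivialCliqueProg {W : ℕ} {O : Oracle} {s : State} (hW : 1 ≤ W) :
    Emits W O 1 6 trivialCliqueProg s 35 [true, false, true, false, false] := by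
  have h := fun b => emits_bit (O := O) (A := 1) (d := 6) (s := s) (by omega) hW b
  exact (h true).seq <| (h false).seq <| (h true).seq <| (h false).seq (h false)

open Classical in
-- `hW` bounds the length of the input, hence every position that is read; `hW'` bounds the length
-- of the output in both cases.
theorem run_complementReduction {O : Oracle} {W a b k : ℕ} {r : Fin a → Fin b → Prop}
    {E : ℕ → ℕ → Prop} (hE : ∀ (u : Fin a) (v : Fin b), E u v ↔ r u v)
    (hW : a + b + k + a * b + 3 ≤ W)
    (hW' : a + b + k + 5 + (a + b) * (a + b) ≤ W) :
    Run W O 6 complementReduction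
      (State.init (unaryThen a (unaryThen b (unaryThen k (matrixBits r)))))
      (22 * (a + b + k) + 100 + (a + b) * (34 * (a + b) + 10))
      ((((State.init (unaryThen a (unaryThen b (unaryThen k (matrixBits r))))).setReg 3 a).setReg 4
        b |>.setReg 5 k |>.setReg 2 (a + b + k + 3)).write 1 1
        (if k ≠ 0 then unaryThen (a + b) (unaryThen k ((bipartiteVertices a b).flatMap fun x =>
          (bipartiteVertices a b).map fun y => decide (CoAdj E x y)))
        else [true, false, true, false, false])) := by
  set s := State.init (unaryThen a (unaryThen b (unaryThen k (matrixBits r)))) with hs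
  have reg0 : ∀ x, x ≠ 0 → s.reg x = 0 := fun x hx => by simp [hs, State.init, hx]
  have S0 : s.Stores 0 0 _ := State.stores_init _
  have S1 := S0.unary_rest
  have S2 := S1.unary_rest
  have S3 := S2.unary_rest
  have r0 := Run.assign (W := W) (O := O) (d := 6) (x := 1) (s := s) (e := .const 0) trivial
    (Nat.zero_le _) (Nat.zero_le _)
  have r1 := run_readUnary (W := W) (O := O) (d := 6) (pos := 2) (cnt := 3)
    (s := s.setReg 1 (Expr.eval (.const 0) s)) (p := 0) (by omega) (by omega) (by omega)
    (by simp [reg0]) (by simp [reg0]) (S0.of_mem_eq rfl) (by omega)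
  have r2 := run_readUnary (W := W) (O := O) (d := 6) (pos := 2) (cnt := 4)
    (s := ((s.setReg 1 (Expr.eval (.const 0) s)).setReg 3 a).setReg 2 (0 + a + 1))
    (p := 0 + a + 1) (by omega) (by omega)
    (by omega) (by simp) (by simp [reg0]) (S1.of_mem_eq rfl) (by omega)
  have r3 := run_readUnary (W := W) (O := O) (d := 6) (pos := 2) (cnt := 5)
    (s := ((((s.setReg 1 (Expr.eval (.const 0) s)).setReg 3 a).setReg 2 (0 + a + 1)).setReg
      4 b).setReg 2 (0 + a + 1 + b + 1)) (p := 0 + a + 1 + b + 1) (by omega) (by omega)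
    (by omega) (by simp) (by simp [reg0]) (S2.of_mem_eq rfl) (by omega)
  set s' := ((s.setReg 3 a).setReg 4 b |>.setReg 5 k |>.setReg 2 (a + b + k + 3)) with hs'
  have hc := Emits.cond (O := O) (W := W) (A := 1) (d := 6) (e := .var 5) (P := k ≠ 0) (s := s')
    (T := 11 * (a + b + k) + 35 + (a + b) * (34 * (a + b) + 10))
    (show 5 < 6 by omega) (fun l0 _ => by simp [Expr.Fits, Expr.eval, hs']; omega)
    (fun _ => (emits_complementProg (a := a) (b := b) (p := a + b + k + 3) (E := E) (k := k)
      (by simp [hs'])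
      (by simp [hs']) (by simp [hs'])
      (by simp [hs']) (fun u hu v hv => ?_) (by omega) (by omega) (by omega) (by omega)
      (by omega)).mono (by omega))
    (fun _ => (emits_trivialCliqueProg (by omega)).mono (by omega))
  · have h5 := hc [] (by
      simp only [List.length_nil, Nat.zero_add]
      split
      · simp [length_unaryThen, bipartiteVertices, Function.comp_def]
        nlinarith
      · simp; omega)
    refine ((r0.seq (r1.seq (r2.seq r3))).seq (h5.congr ?_ (State.Agree.refl _ _))).mono ?_
    · intro x hx
      refine ⟨?_, ?_⟩
      · interval_cases x <;> simp [hs', Expr.eval]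
        omega
      · by_cases h : x = 1 <;> simp [hs', h]
    · simp only [Expr.cost]
      omega
  · have := S3.matrix hu hv
    simp only [hE ⟨u, hu⟩ ⟨v, hv⟩] at this ⊢
    rw [← this]
    simp only [hs', State.setReg_mem]
    congr 1
    omega

end WordRAM

/-! ### Correctness of the reduction to cliques. -/

/-- The complement of a bipartite graph, with its vertices numbered. -/
def BipartiteGraph.numberedCompl (B : BipartiteGraph) : SimpleGraph (Fin (B.left + B.right)) :=
  B.toSimpleGraphᶜ.comap finSumFinEquiv.symm

/-- The instance of counting cliques that belongs to an instance of counting independent sets. -/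
def BISInstance.toClique (x : BISInstance) : CliqueInstance :=
  if h : x.k = 0 then ⟨1, ⊥, 1, one_pos⟩
  else ⟨x.G.left + x.G.right, x.G.numberedCompl, x.k, Nat.pos_of_ne_zero h⟩

theorem BISInstance.toClique_of_eq {x : BISInstance} (h : x.k = 0) :
    x.toClique = ⟨1, ⊥, 1, one_pos⟩ := dif_pos h

theorem BISInstance.toClique_of_ne {x : BISInstance} (h : x.k ≠ 0) :
    x.toClique = ⟨x.G.left + x.G.right, x.G.numberedCompl, x.k, Nat.pos_of_ne_zero h⟩ := dif_neg h

theorem BipartiteGraph.toSimpleGraph_adj (B : BipartiteGraph) (x y) :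
    B.toSimpleGraph.Adj x y ↔
      (∃ e ∈ B.edges, x = .inl e.1 ∧ y = .inr e.2) ∨
        ∃ e ∈ B.edges, y = .inl e.1 ∧ x = .inr e.2 := by
  simp only [toSimpleGraph, SimpleGraph.fromRel_adj]
  constructor
  · exact fun h => h.2
  · refine fun h => ⟨?_, h⟩
    rintro rfl
    rcases h with ⟨e, _, h1, h2⟩ | ⟨e, _, h1, h2⟩ <;> · rw [h1] at h2; cases h2

@[simp] theorem BipartiteGraph.adj_inl_inr (B : BipartiteGraph) (p q) :
    B.toSimpleGraph.Adj (.inl p) (.inr q) ↔ (p, q) ∈ B.edges := by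
  simp [toSimpleGraph_adj]

@[simp] theorem BipartiteGraph.adj_inr_inl (B : BipartiteGraph) (p q) :
    B.toSimpleGraph.Adj (.inr q) (.inl p) ↔ (p, q) ∈ B.edges := by
  simp [toSimpleGraph_adj]

@[simp] theorem BipartiteGraph.not_adj_inl_inl (B : BipartiteGraph) (p q) :
    ¬ B.toSimpleGraph.Adj (.inl p) (.inl q) := by
  simp [toSimpleGraph_adj]

@[simp] theorem BipartiteGraph.not_adj_inr_inr (B : BipartiteGraph) (p q) :
    ¬ B.toSimpleGraph.Adj (.inr p) (.inr q) := by
  simp [toSimpleGraph_adj]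

/-- For `k = 0` both sets have one element, the empty set on one side and the single vertex on the
other. For `k ≠ 0` the numbering of the vertices carries independent sets bijectively to cliques of
the complement. -/
theorem BISInstance.count_toClique (x : BISInstance) :
    countSizeBIS.count x = countCliques.count x.toClique := by
  by_cases h : x.k = 0
  · rw [toClique_of_eq h]
    have e1 : {s | x.G.toSimpleGraph.IsNIndepSet x.k s} = {∅} := by
      ext s
      simp only [Set.mem_ofPred_eq, Set.mem_singleton_iff, SimpleGraph.isNIndepSet_iff, h,
        Finset.card_eq_zero]
      exact ⟨fun h => h.2, fun h => ⟨by simp [h], h⟩⟩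
    have e2 : {s : Finset (Fin 1) | (⊥ : SimpleGraph (Fin 1)).IsNClique 1 s} = {{0}} := by
      ext s
      simp only [Set.mem_ofPred_eq, Set.mem_singleton_iff, SimpleGraph.isNClique_iff]
      constructor
      · rintro ⟨_, h2⟩
        obtain ⟨a, rfl⟩ := Finset.card_eq_one.1 h2
        rw [Subsingleton.elim a 0]
      · rintro rfl
        simp
    simp only [countSizeBIS, countCliques]
    rw [e1, e2, Set.ncard_singleton, Set.ncard_singleton]
  · rw [toClique_of_ne h]
    simp only [countSizeBIS, countCliques]
    symm
    have hi : Function.Injective (fun s : Finset (Fin x.G.left ⊕ Fin x.G.right) =>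
        s.map finSumFinEquiv.toEmbedding) := Finset.map_injective _
    rw [← Set.ncard_image_of_injective _ hi]
    congr 1
    ext s
    simp only [Set.mem_ofPred_eq, Set.mem_image]
    constructor
    · intro hs
      refine ⟨s.map finSumFinEquiv.symm.toEmbedding, ?_, ?_⟩
      · rw [← SimpleGraph.isNClique_compl]
        refine ⟨?_, by simpa using hs.2⟩
        intro p hp q hq hpq
        simp only [Finset.coe_map, Set.mem_image, Finset.mem_coe] at hp hq
        obtain ⟨p, hp, rfl⟩ := hp
        obtain ⟨q, hq, rfl⟩ := hq
        exact hs.1 hp hq (fun h => hpq (by rw [h]))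
      · rw [Finset.map_map]
        ext; simp
    · rintro ⟨s, hs, rfl⟩
      rw [← SimpleGraph.isNClique_compl] at hs
      refine ⟨?_, by simpa using hs.2⟩
      intro p hp q hq hpq
      simp only [Finset.coe_map, Set.mem_image, Finset.mem_coe] at hp hq
      obtain ⟨p, hp, rfl⟩ := hp
      obtain ⟨q, hq, rfl⟩ := hq
      simp only [BipartiteGraph.numberedCompl, SimpleGraph.comap_adj]
      simpa using hs.1 hp hq (fun h => hpq (by rw [h]))

/-- The edges as a relation between numbers. -/
def BipartiteGraph.Edge (B : BipartiteGraph) (u v : ℕ) : Prop :=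
  ∃ (hu : u < B.left) (hv : v < B.right), (⟨u, hu⟩, ⟨v, hv⟩) ∈ B.edges

open Classical in
theorem BISInstance.encode_toClique (x : BISInstance) :
    x.toClique.encode =
      if x.k ≠ 0 then unaryThen (x.G.left + x.G.right) (unaryThen x.k
        ((bipartiteVertices x.G.left x.G.right).flatMap fun u =>
          (bipartiteVertices x.G.left x.G.right).map fun v => decide (CoAdj x.G.Edge u v)))
      else [true, false, true, false, false] := by
  by_cases h : x.k = 0
  · rw [toClique_of_eq h]
    -- The five bits are `1` in unary twice, each with its separator, and the only entry of the
    -- matrix of a loopless graph.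
    simp [h, CliqueInstance.encode, unaryThen, matrixBits]
  · rw [if_pos h]
    rw [toClique_of_ne h]
    simp only [CliqueInstance.encode]
    congr 2
    -- `finSumFinEquiv` numbers the left vertices before the right ones, in the order of
    -- `bipartiteVertices`.
    have key : ∀ (u : Fin (x.G.left + x.G.right))
        (hu : (u : ℕ) < (bipartiteVertices x.G.left x.G.right).length),
        (bipartiteVertices x.G.left x.G.right)[(u : ℕ)] =
          (finSumFinEquiv.symm u).map Fin.val Fin.val := by
      intro u hu
      obtain ⟨w, rfl⟩ := finSumFinEquiv.surjective u
      rw [Equiv.symm_apply_apply]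
      cases w with
      | inl i => simp [bipartiteVertices]
      | inr i => simp [bipartiteVertices]
    refine matrixBits_eq_flatMap (by simp [bipartiteVertices]) (by simp [bipartiteVertices]) _
      fun u v => ?_
    have e1 := key u (by simp [bipartiteVertices])
    have e2 := key v (by simp [bipartiteVertices])
    simp only [Fin.getElem_fin, e1, e2, BipartiteGraph.numberedCompl, SimpleGraph.comap_adj]
    generalize finSumFinEquiv.symm u = p
    generalize finSumFinEquiv.symm v = q
    rcases p with p | p <;> rcases q with q | q <;>
      simp [SimpleGraph.compl_adj, CoAdj, BipartiteGraph.Edge,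
        Fin.ext_iff]

theorem countSizeBIS_mem_sharpW1 : countSizeBIS ∈ SharpW1 := by
  classical
  -- The running time is quadratic in the size whatever the parameter, so `f` is constant. The bound
  -- `k + 1` on the new parameter is there for `k = 0`, where it is `1`.
  refine ⟨BISInstance.toClique, BISInstance.count_toClique, ⟨complementReduction,
    fun _ => 200, 2, Computable.const _, fun x => ?_⟩, fun k => k + 1,
    Primrec.succ.to_comp, fun x => ?_⟩
  · have hsize : countSizeBIS.size x =
        x.G.left + x.G.right + x.k + x.G.left * x.G.right + 4 := by
      simp only [ParamCountingProblem.size, countSizeBIS, BISInstance.encode,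
        length_unaryThen, length_matrixBits]
      omega
    obtain ⟨⟨a, b, E⟩, k⟩ := x
    dsimp only at hsize
    have hlen : (countSizeBIS.encode ⟨⟨a, b, E⟩, k⟩).length + 1 =
        countSizeBIS.size ⟨⟨a, b, E⟩, k⟩ :=
      rfl
    set N := countSizeBIS.size ⟨⟨a, b, E⟩, k⟩ with hN
    have h1 : a + b + k + 4 ≤ N := by omega
    have h2 : N ≤ 200 * N ^ 2 := by nlinarith
    have hab : (a + b) * (a + b) ≤ N * N := Nat.mul_le_mul (by omega) (by omega)
    have hr := run_complementReduction (O := noOracle) (W := 200 * N ^ 2) (a := a) (b := b) (k := k)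
      (r := fun u v => (u, v) ∈ E) (E := BipartiteGraph.Edge ⟨a, b, E⟩)
      (fun u v => by simp only [BipartiteGraph.Edge, Fin.is_lt, exists_true_left, Fin.eta])
      (by omega) (by nlinarith)
    change ComputesWithin (200 * N ^ 2) _ _ _ _
    refine ⟨by omega, ?_⟩
    obtain ⟨t, ht, s, hs, e⟩ := hr _ (State.Agree.refl _ _)
    refine ⟨t, ht.trans (by nlinarith), s, e, State.Holds.of_agree hs (by omega) (by omega) ?_⟩
    have he := BISInstance.encode_toClique ⟨⟨a, b, E⟩, k⟩
    change State.Holds _ 1 1 (CliqueInstance.encode _)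
    rw [he]
    exact State.holds_write _ 1 1 _
  · simp only [countCliques, countSizeBIS, BISInstance.toClique]
    split
    · simp
    · simp

/-! ## Cliques as signed sums of numbers of independent sets -/

namespace Selector

/-- The number of binary digits of `m` at positions below `K` that are `1`. -/
def bitSum (K m : ℕ) : ℕ := ∑ g ∈ Finset.range K, (m.testBit g).toNat

/-- With the sign written as a product over the positions, only the factor at `g` changes. -/
theorem bitSum_flip {K m g : ℕ} (hg : g < K) :
    (-1 : ℤ) ^ bitSum K (m ^^^ 2 ^ g) = -(-1) ^ bitSum K m := by
  simp only [bitSum, ← Finset.prod_pow_eq_pow_sum]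
  rw [← Finset.mul_prod_erase _ _ (Finset.mem_range.2 hg),
    ← Finset.mul_prod_erase _ _ (Finset.mem_range.2 hg)]
  have h : ∀ i ∈ (Finset.range K).erase g,
      (-1 : ℤ) ^ ((m ^^^ 2 ^ g).testBit i).toNat = (-1) ^ (m.testBit i).toNat := by
    intro i hi
    have : g ≠ i := (Finset.ne_of_mem_erase hi).symm
    simp [Nat.testBit_xor, this]
  rw [Finset.prod_congr rfl h, ← neg_mul]
  congr 1
  simp only [Nat.testBit_xor, Nat.testBit_two_pow_self]
  cases m.testBit g <;> simp

/-- Inclusion-exclusion, with `B` the set of groups that are met. If `g` is missing from `B`,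
flipping bit `g` is a sign-reversing involution on the masks that contain `B`; if nothing is
missing, only the full mask `2 ^ K - 1` contains `B`. -/
theorem sum_signed_masks (K : ℕ) (B : Finset ℕ) (hB : B ⊆ Finset.range K) :
    (∑ m ∈ Finset.range (2 ^ K), if ∀ g ∈ B, m.testBit g then (-1 : ℤ) ^ bitSum K m else 0) =
      if B = Finset.range K then (-1) ^ K else 0 := by
  split
  · next h =>
    subst h
    rw [Finset.sum_eq_single (2 ^ K - 1)]
    · rw [if_pos]
      · congr 1
        rw [bitSum, Finset.sum_congr rfl (g := fun _ => 1)]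
        · simp
        · intro g hg
          simp [Nat.testBit_two_pow_sub_one, Finset.mem_range.1 hg]
      · intro g hg
        simpa [Nat.testBit_two_pow_sub_one] using hg
    · intro m hm hne
      rw [if_neg]
      intro h
      refine hne (Nat.eq_of_testBit_eq fun i => ?_)
      rw [Nat.testBit_two_pow_sub_one]
      by_cases hi : i < K
      · simp [hi, h i (Finset.mem_range.2 hi)]
      · have : m < 2 ^ i := (Finset.mem_range.1 hm).trans_le
          (Nat.pow_le_pow_right two_pos (not_lt.1 hi))
        simp [hi, Nat.testBit_lt_two_pow this]
    · intro h
      exact absurd (Finset.mem_range.2 (Nat.sub_lt (by positivity) one_pos)) h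
  · next h =>
    obtain ⟨g, hg, hgB⟩ : ∃ g ∈ Finset.range K, g ∉ B := by
      by_contra hcon
      push Not at hcon
      exact h (hB.antisymm hcon)
    have hgK := Finset.mem_range.1 hg
    have hiff : ∀ m, (∀ i ∈ B, (m ^^^ 2 ^ g).testBit i) ↔ ∀ i ∈ B, m.testBit i := by
      intro m
      refine forall₂_congr fun i hi => ?_
      have : g ≠ i := fun h => hgB (h ▸ hi)
      simp [Nat.testBit_xor, this]
    refine Finset.sum_involution (fun m _ => m ^^^ 2 ^ g) ?_ ?_ ?_ ?_
    · intro m _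
      simp only [hiff, bitSum_flip hgK]
      split <;> simp
    · intro m _ _ heq
      have := congrArg (fun x => x.testBit g) heq
      simp [Nat.testBit_xor] at this
    · intro m hm
      exact Finset.mem_range.2 (Nat.xor_lt_two_pow (Finset.mem_range.1 hm)
        (Nat.pow_lt_pow_right one_lt_two hgK))
    · intro m _
      simp

/-- The pairs of a left vertex `(i, u)` and a right vertex `(k + j, v)` that may be chosen
together. -/
def Compatible (A : ℕ → ℕ → Prop) (i u j v : ℕ) : Prop :=
  (i = j ∧ u = v) ∨ (i < j ∧ u < v ∧ A u v) ∨ j < i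

/-- Independent sets in the bipartite graph with left vertices `(i, u)` and right vertices
`(k + j, v)`, where `i, j < k`. -/
def Indep (A : ℕ → ℕ → Prop) (k : ℕ) (S : Finset (ℕ × ℕ)) : Prop :=
  ∀ x ∈ S, x.1 < k → ∀ y ∈ S, k ≤ y.1 → Compatible A x.1 x.2 (y.1 - k) y.2

open Classical in
/-- The independent sets of size `2 * k`. -/
noncomputable def family (A : ℕ → ℕ → Prop) (k n : ℕ) : Finset (Finset (ℕ × ℕ)) :=
  ((Finset.range (2 * k) ×ˢ Finset.range n).powersetCard (2 * k)).filter (Indep A k)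

open Classical in
/-- The number of independent sets of size `2 * k` inside the groups given by the mask `m`. -/
noncomputable def maskCount (A : ℕ → ℕ → Prop) (k n m : ℕ) : ℕ :=
  ((family A k n).filter fun S => ∀ x ∈ S, m.testBit x.1).card

variable {A : ℕ → ℕ → Prop} {k n : ℕ}

theorem mem_family {S : Finset (ℕ × ℕ)} : S ∈ family A k n ↔
    ((∀ x ∈ S, x.1 < 2 * k ∧ x.2 < n) ∧ S.card = 2 * k) ∧ Indep A k S := by
  simp [family, Finset.subset_iff]

open Classical in
-- After exchanging the sums, a set `S` contributes the signed number of the masks containing its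
-- groups, to which `sum_signed_masks` applies. No global sign remains because `2 * k` is even.
theorem sum_maskCount : ∑ m ∈ Finset.range (2 ^ (2 * k)),
    (-1 : ℤ) ^ bitSum (2 * k) m * maskCount A k n m =
      ((family A k n).filter fun S => ∀ g < 2 * k, ∃ x ∈ S, x.1 = g).card := by
  simp only [maskCount, Finset.card_filter, Nat.cast_sum, Finset.mul_sum]
  rw [Finset.sum_comm]
  refine Finset.sum_congr rfl fun S hS => ?_
  have hS' := (mem_family.1 hS).1.1
  have key := sum_signed_masks (2 * k) (S.image Prod.fst) (by
    intro g hg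
    obtain ⟨x, hx, rfl⟩ := Finset.mem_image.1 hg
    exact Finset.mem_range.2 (hS' x hx).1)
  have e1 : (S.image Prod.fst = Finset.range (2 * k)) ↔ ∀ g < 2 * k, ∃ x ∈ S, x.1 = g := by
    constructor
    · intro h g hg
      have : g ∈ S.image Prod.fst := by rw [h]; exact Finset.mem_range.2 hg
      simpa using this
    · intro h
      refine subset_antisymm ?_ ?_
      · intro g hg
        obtain ⟨x, hx, rfl⟩ := Finset.mem_image.1 hg
        exact Finset.mem_range.2 (hS' x hx).1
      · intro g hg
        exact Finset.mem_image.2 (h g (Finset.mem_range.1 hg))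
  simp only [e1, Finset.forall_mem_image, (even_two_mul k).neg_one_pow] at key
  rw [Nat.cast_ite, Nat.cast_one, Nat.cast_zero, ← key]
  refine Finset.sum_congr rfl fun m _ => ?_
  split <;> simp

/-! ### Independent sets that meet every group, and cliques. -/

/-- The increasing enumerations of cliques. -/
def Chain (A : ℕ → ℕ → Prop) (k n : ℕ) (x : ℕ → ℕ) : Prop :=
  (∀ i < k, x i < n) ∧ ∀ i j, i < j → j < k → x i < x j ∧ A (x i) (x j)

/-- The set with exactly one vertex of each group that belongs to a sequence. -/
def select (k : ℕ) (x : ℕ → ℕ) : Finset (ℕ × ℕ) :=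
  (Finset.range (2 * k)).image fun g => (g, x (g % k))

theorem mem_select {x : ℕ → ℕ} {p : ℕ × ℕ} :
    p ∈ select k x ↔ p.1 < 2 * k ∧ p.2 = x (p.1 % k) := by
  simp only [select, Finset.mem_image, Finset.mem_range]
  constructor
  · rintro ⟨g, hg, rfl⟩
    exact ⟨hg, rfl⟩
  · rintro ⟨h1, h2⟩
    exact ⟨p.1, h1, by rw [← h2]⟩

theorem select_congr {x y : ℕ → ℕ} (h : ∀ i < k, x i = y i) : select k x = select k y := by
  ext p
  simp only [mem_select]
  refine and_congr_right fun hp => ?_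
  rw [h _ (Nat.mod_lt _ (by omega))]

/-- A set of `2 * k` elements meeting all `2 * k` groups has exactly one element `y g` in each.
Compatibility of the groups `i` and `k + i` forces `y (k + i) = y i`; then compatibility of `i` and
`k + j` for `i < j` says that `y i < y j` and that they are adjacent, and for `j < i` it says
nothing. -/
theorem colourful_iff {S : Finset (ℕ × ℕ)} :
    (S ∈ family A k n ∧ ∀ g < 2 * k, ∃ x ∈ S, x.1 = g) ↔ ∃ x, Chain A k n x ∧ S = select k x := by
  rw [mem_family]
  constructor
  · rintro ⟨⟨⟨hV, hcard⟩, hI⟩, hcol⟩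
    have : ∀ g, ∃ u, g < 2 * k → (g, u) ∈ S := by
      intro g
      by_cases hg : g < 2 * k
      · obtain ⟨⟨_, u⟩, hx, rfl⟩ := hcol g hg
        exact ⟨u, fun _ => hx⟩
      · exact ⟨0, fun h => absurd h hg⟩
    choose y hy using this
    have himg : (Finset.range (2 * k)).image (fun g => (g, y g)) = S := by
      refine Finset.eq_of_subset_of_card_le ?_ ?_
      · intro p hp
        obtain ⟨g, hg, rfl⟩ := Finset.mem_image.1 hp
        exact hy g (Finset.mem_range.1 hg)
      · rw [hcard, Finset.card_image_of_injective _ fun a b h => congrArg Prod.fst h]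
        simp
    have hc : ∀ i < k, ∀ j < k, Compatible A i (y i) j (y (k + j)) := by
      intro i hi j hj
      simpa using hI _ (hy i (by omega)) hi _ (hy (k + j) (by omega)) (Nat.le_add_right k j)
    have heq : ∀ i < k, y (k + i) = y i := by
      intro i hi
      rcases hc i hi i hi with h | h | h
      · exact h.2.symm
      · exact absurd h.1 (lt_irrefl i)
      · exact absurd h (lt_irrefl i)
    refine ⟨y, ⟨fun i hi => (hV _ (hy i (by omega))).2, fun i j hij hj => ?_⟩, ?_⟩
    · rcases hc i (by omega) j hj with h | h | h
      · omega
      · rw [heq j hj] at h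
        exact h.2
      · omega
    · rw [← himg, select]
      refine Finset.image_congr fun g hg => ?_
      have hg' : g < 2 * k := by simpa using hg
      by_cases h : g < k
      · simp [Nat.mod_eq_of_lt h]
      · obtain ⟨j, rfl⟩ := Nat.exists_eq_add_of_le (not_lt.1 h)
        simp [Nat.mod_eq_of_lt (show j < k by omega), heq j (by omega)]
  · rintro ⟨x, ⟨hn, hx⟩, rfl⟩
    refine ⟨⟨⟨fun p hp => ?_, ?_⟩, ?_⟩, fun g hg => ⟨(g, x (g % k)), mem_select.2 ⟨hg, rfl⟩, rfl⟩⟩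
    · obtain ⟨h1, h2⟩ := mem_select.1 hp
      exact ⟨h1, by rw [h2]; exact hn _ (Nat.mod_lt _ (by omega))⟩
    · rw [select, Finset.card_image_of_injective _ fun a b h => congrArg Prod.fst h]
      simp
    · intro p hp hpk q hq hqk
      obtain ⟨h1, h2⟩ := mem_select.1 hp
      obtain ⟨h3, h4⟩ := mem_select.1 hq
      obtain ⟨j, hj⟩ := Nat.exists_eq_add_of_le hqk
      have hjk : j < k := by omega
      rw [Nat.mod_eq_of_lt hpk] at h2
      rw [hj, Nat.add_mod_left, Nat.mod_eq_of_lt hjk] at h4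
      rw [hj, Nat.add_sub_cancel_left, h2, h4]
      rcases lt_trichotomy p.1 j with h | h | h
      · exact .inr (.inl ⟨h, hx _ _ h hjk⟩)
      · exact .inl ⟨h, by rw [h]⟩
      · exact .inr (.inr h)

/-- An increasing sequence is determined by its set of values: both sequences are the unique order
embedding of `Fin k` onto the same `k`-element set. -/
theorem Chain.ext_image {x y : ℕ → ℕ} (hx : Chain A k n x) (hy : Chain A k n y)
    (h : ∀ u, (∃ i < k, x i = u) ↔ ∃ i < k, y i = u) : ∀ i < k, x i = y i := by
  set s := (Finset.range k).image x with hs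
  have hinj : Set.InjOn x (Finset.range k) := by
    intro a ha b hb hab
    have ha' : a < k := by simpa using ha
    have hb' : b < k := by simpa using hb
    rcases lt_trichotomy a b with h | h | h
    · exact absurd hab (hx.2 a b h hb').1.ne
    · exact h
    · exact absurd hab (hx.2 b a h ha').1.ne'
  have hcard : s.card = k := by rw [hs, Finset.card_image_of_injOn hinj, Finset.card_range]
  have e1 := Finset.orderEmbOfFin_unique hcard (f := fun i : Fin k => x i)
    (fun i => Finset.mem_image_of_mem _ (Finset.mem_range.2 i.2))
    fun i j hij => (hx.2 i j hij j.2).1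
  have e2 := Finset.orderEmbOfFin_unique hcard (f := fun i : Fin k => y i)
    (fun i => by
      obtain ⟨j, hj, e⟩ := (h (y i)).2 ⟨i, i.2, rfl⟩
      exact Finset.mem_image.2 ⟨j, Finset.mem_range.2 hj, e⟩) fun i j hij => (hy.2 i j hij j.2).1
  intro i hi
  exact congrFun (e1.trans e2.symm) ⟨i, hi⟩

/-- The adjacency relation of a graph as a relation between numbers. -/
def adjNat (G : SimpleGraph (Fin n)) (u v : ℕ) : Prop :=
  ∃ (hu : u < n) (hv : v < n), G.Adj ⟨u, hu⟩ ⟨v, hv⟩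

open Classical in
-- As chains are increasing, a clique comes from one chain rather than from `k!` orderings, and no
-- division is needed.
theorem card_colourful (G : SimpleGraph (Fin n)) :
    ((family (adjNat G) k n).filter fun S => ∀ g < 2 * k, ∃ x ∈ S, x.1 = g).card =
      Set.ncard {s : Finset (Fin n) | G.IsNClique k s} := by
  rw [Set.ncard_eq_toFinset_card']
  have hval : ∀ x : ℕ → ℕ, ∀ u : Fin n, (∃ g, (g, (u : ℕ)) ∈ select k x) ↔ ∃ i < k, x i = u := by
    intro x u
    constructor
    · rintro ⟨g, hg⟩
      obtain ⟨h1, h2⟩ := mem_select.1 hg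
      exact ⟨g % k, Nat.mod_lt _ (by dsimp only at h1; omega), h2.symm⟩
    · rintro ⟨i, hi, h⟩
      exact ⟨i, mem_select.2 ⟨by dsimp only; omega, by dsimp only; rw [Nat.mod_eq_of_lt hi, h]⟩⟩
  refine Finset.card_bij
    (fun S _ => Finset.univ.filter fun u : Fin n => ∃ g, (g, (u : ℕ)) ∈ S) ?_ ?_ ?_
  · intro S hS
    obtain ⟨x, hx, rfl⟩ := colourful_iff.1 (Finset.mem_filter.1 hS)
    simp only [Set.mem_toFinset, Set.mem_ofPred_eq, hval]
    refine ⟨?_, ?_⟩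
    · intro u hu v hv huv
      obtain ⟨i, hi, hiu⟩ : ∃ i < k, x i = u := by simpa using hu
      obtain ⟨j, hj, hjv⟩ : ∃ i < k, x i = v := by simpa using hv
      rcases lt_trichotomy i j with h | h | h
      · obtain ⟨_, _, h3⟩ := (hx.2 i j h hj).2
        simpa [hiu, hjv] using h3
      · exact absurd (Fin.ext (by rw [← hiu, ← hjv, h])) huv
      · obtain ⟨_, _, h3⟩ := (hx.2 j i h hi).2
        simpa [hiu, hjv] using h3.symm
    · have : (Finset.univ.filter fun u : Fin n => ∃ i < k, x i = u) =
          (Finset.univ : Finset (Fin k)).image fun i => ⟨x i, hx.1 i i.2⟩ := by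
        ext u
        simp only [Finset.mem_filter, Finset.mem_univ, true_and, Finset.mem_image, Fin.ext_iff]
        exact ⟨fun ⟨i, hi, h⟩ => ⟨⟨i, hi⟩, h⟩, fun ⟨i, h⟩ => ⟨i, i.2, h⟩⟩
      rw [this, Finset.card_image_of_injective]
      · simp
      · intro i j hij
        have hij' : x i = x j := congrArg Fin.val hij
        rcases lt_trichotomy i j with h | h | h
        · exact absurd hij' (hx.2 i j h j.2).1.ne
        · exact h
        · exact absurd hij' (hx.2 j i h i.2).1.ne'
  · intro S hS S' hS' h
    obtain ⟨x, hx, rfl⟩ := colourful_iff.1 (Finset.mem_filter.1 hS)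
    obtain ⟨y, hy, rfl⟩ := colourful_iff.1 (Finset.mem_filter.1 hS')
    refine select_congr (hx.ext_image hy fun u => ?_)
    by_cases hu : u < n
    · have := congrArg (fun s => (⟨u, hu⟩ : Fin n) ∈ s) h
      simpa [hval x ⟨u, hu⟩, hval y ⟨u, hu⟩] using this
    · constructor
      · rintro ⟨i, hi, rfl⟩
        exact absurd (hx.1 i hi) hu
      · rintro ⟨i, hi, rfl⟩
        exact absurd (hy.1 i hi) hu
  · intro s hs
    have hs : G.IsNClique k s := by simpa using hs
    let e := s.orderEmbOfFin hs.2
    -- The value beyond `k` is immaterial, since `select k x` uses `x` only at arguments below `k`.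
    let x : ℕ → ℕ := fun i => if h : i < k then e ⟨i, h⟩ else 0
    have hxe : ∀ i (h : i < k), x i = e ⟨i, h⟩ := fun i h => dif_pos h
    have hx : Chain (adjNat G) k n x := by
      refine ⟨fun i hi => by rw [hxe i hi]; exact Fin.is_lt _, fun i j hij hj => ?_⟩
      have hi : i < k := hij.trans hj
      have hlt : e ⟨i, hi⟩ < e ⟨j, hj⟩ := e.strictMono hij
      rw [hxe i hi, hxe j hj]
      refine ⟨hlt, Fin.is_lt _, Fin.is_lt _, ?_⟩
      exact hs.1 (Finset.orderEmbOfFin_mem _ hs.2 _) (Finset.orderEmbOfFin_mem _ hs.2 _) hlt.ne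
    refine ⟨select k x, Finset.mem_filter.2 (colourful_iff.2 ⟨x, hx, rfl⟩), ?_⟩
    ext u
    simp only [Finset.mem_filter, Finset.mem_univ, true_and, hval]
    constructor
    · rintro ⟨i, hi, h⟩
      rw [hxe i hi] at h
      rw [← Fin.ext h]
      exact Finset.orderEmbOfFin_mem _ _ _
    · intro hu
      have : u ∈ Set.range e := by rw [Finset.range_orderEmbOfFin]; exact hu
      obtain ⟨i, rfl⟩ := this
      exact ⟨i, i.2, hxe i i.2⟩

end Selector

/-! ## The instances for the oracle -/

namespace Selector

/-- The left vertices in the groups given by the mask `m`. -/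
def leftVertices (k n m : ℕ) : List (ℕ × ℕ) :=
  (List.range k).flatMap fun i => if m.testBit i then (List.range n).map fun u => (i, u) else []

/-- The right vertices in the groups given by the mask `m`. -/
def rightVertices (k n m : ℕ) : List (ℕ × ℕ) :=
  (List.range k).flatMap fun j =>
    if m.testBit (k + j) then (List.range n).map fun v => (j, v) else []

/-- Adjacency of a left and a right vertex. -/
def Conflict (A : ℕ → ℕ → Prop) (x y : ℕ × ℕ) : Prop := ¬ Compatible A x.1 x.2 y.1 y.2

/-- The bipartite graph on the groups given by the mask `m`, and the size `2 * k`. -/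
def maskInstance (A : ℕ → ℕ → Prop) (k n m : ℕ) : BISInstance where
  G :=
    { left := (leftVertices k n m).length
      right := (rightVertices k n m).length
      edges := {e | ¬ Compatible A (leftVertices k n m)[e.1].1 (leftVertices k n m)[e.1].2
        (rightVertices k n m)[e.2].1 (rightVertices k n m)[e.2].2} }
  k := 2 * k

variable {A : ℕ → ℕ → Prop} {k n m : ℕ}

theorem mem_leftVertices {x : ℕ × ℕ} :
    x ∈ leftVertices k n m ↔ x.1 < k ∧ m.testBit x.1 ∧ x.2 < n := by
  obtain ⟨i, u⟩ := x
  simp only [leftVertices, List.mem_flatMap, List.mem_range]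
  constructor
  · rintro ⟨i', hi, h⟩
    split at h
    · next ht =>
      obtain ⟨u', hu, h⟩ := List.mem_map.1 h
      cases h
      exact ⟨hi, ht, List.mem_range.1 hu⟩
    · simp at h
  · rintro ⟨hi, ht, hu⟩
    exact ⟨i, hi, by simp_all⟩

theorem mem_rightVertices {x : ℕ × ℕ} :
    x ∈ rightVertices k n m ↔ x.1 < k ∧ m.testBit (k + x.1) ∧ x.2 < n := by
  obtain ⟨i, u⟩ := x
  simp only [rightVertices, List.mem_flatMap, List.mem_range]
  constructor
  · rintro ⟨i', hi, h⟩
    split at h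
    · next ht =>
      obtain ⟨u', hu, h⟩ := List.mem_map.1 h
      cases h
      exact ⟨hi, ht, List.mem_range.1 hu⟩
    · simp at h
  · rintro ⟨hi, ht, hu⟩
    exact ⟨i, hi, by simp_all⟩

theorem nodup_flatMap_groups (k n : ℕ) (c : ℕ → Bool) : ((List.range k).flatMap fun i =>
    if c i then (List.range n).map fun u => (i, u) else []).Nodup := by
  rw [List.nodup_flatMap]
  constructor
  · intro i _
    split
    · exact (List.nodup_range).map fun a b h => congrArg Prod.snd h
    · exact List.nodup_nil
  · refine List.nodup_range.imp fun {i j} hij => ?_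
    intro x hx hy
    simp only at hx hy
    split at hx
    · split at hy
      · obtain ⟨_, _, rfl⟩ := List.mem_map.1 hx
        obtain ⟨_, _, h⟩ := List.mem_map.1 hy
        exact hij (congrArg Prod.fst h).symm
      · simp at hy
    · simp at hx

theorem length_flatMap_groups_le (k n : ℕ) (c : ℕ → Bool) : ((List.range k).flatMap fun i =>
    if c i then (List.range n).map fun u => (i, u) else []).length ≤ k * n := by
  induction k with
  | zero => simp
  | succ k ih =>
    rw [List.range_succ, List.flatMap_append, List.length_append, Nat.succ_mul]
    refine add_le_add ih ?_
    simp only [List.flatMap_singleton]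
    split <;> simp

theorem length_leftVertices_le : (leftVertices k n m).length ≤ k * n :=
  length_flatMap_groups_le k n fun i => m.testBit i

theorem length_rightVertices_le : (rightVertices k n m).length ≤ k * n :=
  length_flatMap_groups_le k n fun j => m.testBit (k + j)

/-- The vertices of the instance for the mask `m`, as pairs of a group and a number. -/
def vertex (A : ℕ → ℕ → Prop) (k n m : ℕ) :
    Fin (maskInstance A k n m).G.left ⊕ Fin (maskInstance A k n m).G.right → ℕ × ℕ
  | .inl p => (leftVertices k n m)[(p : ℕ)]'p.2
  | .inr q => (k + ((rightVertices k n m)[(q : ℕ)]'q.2).1, ((rightVertices k n m)[(q : ℕ)]'q.2).2)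

theorem vertex_inl_lt (p) : (vertex A k n m (.inl p)).1 < k :=
  (mem_leftVertices.1 (List.getElem_mem p.2)).1

theorem le_vertex_inr (q) : k ≤ (vertex A k n m (.inr q)).1 := Nat.le_add_right _ _

theorem mem_edges_maskInstance (p q) : (p, q) ∈ (maskInstance A k n m).G.edges ↔
    ¬ Compatible A (vertex A k n m (.inl p)).1 (vertex A k n m (.inl p)).2
      ((vertex A k n m (.inr q)).1 - k) (vertex A k n m (.inr q)).2 := by
  have : (vertex A k n m (.inr q)).1 - k = ((rightVertices k n m)[(q : ℕ)]'q.2).1 :=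
    Nat.add_sub_cancel_left k _
  rw [this]
  exact Iff.rfl

theorem vertex_injective : Function.Injective (vertex A k n m) := by
  rintro (p | p) (q | q) h
  · exact congrArg Sum.inl (Fin.ext ((nodup_flatMap_groups k n _).getElem_inj_iff.1 h))
  · have h1 := vertex_inl_lt p
    rw [h] at h1
    exact absurd h1 (not_lt.2 (le_vertex_inr q))
  · have h1 := vertex_inl_lt q
    rw [← h] at h1
    exact absurd h1 (not_lt.2 (le_vertex_inr p))
  · have h1 : (rightVertices k n m)[(p : ℕ)]'p.2 = (rightVertices k n m)[(q : ℕ)]'q.2 := by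
      have h2 := congrArg Prod.fst h
      have h3 := congrArg Prod.snd h
      exact Prod.ext (Nat.add_left_cancel h2) h3
    exact congrArg Sum.inr (Fin.ext ((nodup_flatMap_groups k n _).getElem_inj_iff.1 h1))

theorem exists_vertex_iff {x : ℕ × ℕ} :
    (∃ w, vertex A k n m w = x) ↔ x.1 < 2 * k ∧ x.2 < n ∧ m.testBit x.1 := by
  constructor
  · rintro ⟨p | q, rfl⟩
    · have := mem_leftVertices.1 (List.getElem_mem p.2)
      exact ⟨by have := vertex_inl_lt p; omega, this.2.2, this.2.1⟩
    · have := mem_rightVertices.1 (List.getElem_mem q.2)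
      exact ⟨by have := this.1; simp only [vertex]; omega, this.2.2, this.2.1⟩
  · rintro ⟨h1, h2, h3⟩
    by_cases hx : x.1 < k
    · obtain ⟨i, hi, h⟩ := List.mem_iff_getElem.1 (mem_leftVertices.2 ⟨hx, h3, h2⟩)
      exact ⟨.inl ⟨i, hi⟩, h⟩
    · obtain ⟨j, hj⟩ := Nat.exists_eq_add_of_le (not_lt.1 hx)
      have hmem : (j, x.2) ∈ rightVertices k n m :=
        mem_rightVertices.2 ⟨show j < k by omega, by rwa [hj] at h3, h2⟩
      obtain ⟨i, hi, h⟩ := List.mem_iff_getElem.1 hmem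
      refine ⟨.inr ⟨i, hi⟩, ?_⟩
      have h5 := congrArg Prod.fst h
      have h6 := congrArg Prod.snd h
      exact Prod.ext ((congrArg (k + ·) h5).trans hj.symm) h6

theorem indep_map_vertex
    (T : Finset (Fin (maskInstance A k n m).G.left ⊕ Fin (maskInstance A k n m).G.right)) :
    (maskInstance A k n m).G.toSimpleGraph.IsIndepSet T ↔
      Indep A k (T.map ⟨vertex A k n m, vertex_injective⟩) := by
  simp only [Indep, Finset.forall_mem_map, Function.Embedding.coeFn_mk]
  constructor
  · intro h x hx hxk y hy hyk
    rcases x with p | p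
    · rcases y with q | q
      · exact absurd (vertex_inl_lt q) (not_lt.2 hyk)
      · have h1 : ¬ (maskInstance A k n m).G.toSimpleGraph.Adj _ _ := h hx hy (by simp)
        rwa [BipartiteGraph.adj_inl_inr, mem_edges_maskInstance, not_not] at h1
    · exact absurd hxk (not_lt.2 (le_vertex_inr p))
  · intro h x hx y hy _
    rcases x with p | p <;> rcases y with q | q
    · exact BipartiteGraph.not_adj_inl_inl _ _ _
    · rw [BipartiteGraph.adj_inl_inr, mem_edges_maskInstance, not_not]
      exact h _ hx (vertex_inl_lt p) _ hy (le_vertex_inr q)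
    · rw [BipartiteGraph.adj_inr_inl, mem_edges_maskInstance, not_not]
      exact h _ hy (vertex_inl_lt q) _ hx (le_vertex_inr p)
    · exact BipartiteGraph.not_adj_inr_inr _ _ _

/-- The injection `vertex` has exactly the vertices of the groups in `m` as its range, and it
translates independence into `Indep`; taking images of sets is thus a bijection between the two
families. -/
theorem count_maskInstance : countSizeBIS.count (maskInstance A k n m) = maskCount A k n m := by
  classical
  rw [maskCount, ← Set.ncard_coe_finset]
  simp only [countSizeBIS]
  have hinj := Finset.map_injective
    (⟨vertex A k n m, vertex_injective⟩ : Function.Embedding _ (ℕ × ℕ))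
  refine (Set.ncard_image_of_injective _ hinj).symm.trans ?_
  congr 1
  ext S
  simp only [Set.mem_image, Set.mem_ofPred_eq, Finset.coe_filter, mem_family]
  constructor
  · rintro ⟨T, hT, rfl⟩
    have hv : ∀ x ∈ T.map ⟨vertex A k n m, vertex_injective⟩,
        x.1 < 2 * k ∧ x.2 < n ∧ m.testBit x.1 := by
      intro x hx
      obtain ⟨w, _, hw⟩ := Finset.mem_map.1 hx
      exact exists_vertex_iff.1 ⟨w, hw⟩
    refine ⟨⟨⟨fun x hx => ⟨(hv x hx).1, (hv x hx).2.1⟩, ?_⟩, (indep_map_vertex T).1 hT.1⟩,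
      fun x hx => (hv x hx).2.2⟩
    rw [Finset.card_map]
    exact hT.2
  · rintro ⟨⟨⟨h1, h2⟩, h3⟩, h4⟩
    have hS : (Finset.univ.filter fun w => vertex A k n m w ∈ S).map
        ⟨vertex A k n m, vertex_injective⟩ = S := by
      ext x
      simp only [Finset.mem_map, Finset.mem_filter, Finset.mem_univ, true_and,
        Function.Embedding.coeFn_mk]
      constructor
      · rintro ⟨w, hw, rfl⟩
        exact hw
      · intro hx
        obtain ⟨w, rfl⟩ := exists_vertex_iff (A := A).2 ⟨(h1 x hx).1, (h1 x hx).2, h4 x hx⟩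
        exact ⟨w, hx, rfl⟩
    refine ⟨_, ⟨(indep_map_vertex _).2 ?_, ?_⟩, hS⟩
    · rwa [hS]
    · rw [← hS, Finset.card_map] at h2
      exact h2

open Classical in
theorem encode_maskInstance : countSizeBIS.encode (maskInstance A k n m) =
    unaryThen (leftVertices k n m).length (unaryThen (rightVertices k n m).length
      (unaryThen (2 * k) ((leftVertices k n m).flatMap fun x => (rightVertices k n m).map fun y =>
        decide (Conflict A x y)))) := by
  simp only [countSizeBIS, BISInstance.encode]
  congr 3
  exact matrixBits_eq_flatMap rfl rfl (Conflict A) fun u v => Iff.rfl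

/-- The crude bound by all sets of vertices suffices: it is used only to see that the counts have
about `2 * k * n` binary digits. -/
theorem card_family_le : (family A k n).card ≤ 2 ^ (2 * k * n) := by
  classical
  refine (Finset.card_le_card (t := (Finset.range (2 * k) ×ˢ Finset.range n).powerset) ?_).trans ?_
  · intro S hS
    refine Finset.mem_powerset.2 fun x hx => ?_
    have := (mem_family.1 hS).1.1 x hx
    simpa using this
  · simp

theorem maskCount_le : maskCount A k n m ≤ 2 ^ (2 * k * n) := by
  classical
  exact (Finset.card_le_card (Finset.filter_subset _ _)).trans card_family_le

end Selector

/-! ## Binary expansions -/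

theorem getElem_bits (r i : ℕ) (h : i < r.bits.length) : r.bits[i] = r.testBit i := by
  rw [Nat.testBit_eq_inth, List.getI_eq_getElem _ h]

theorem testBit_of_size_le {r i : ℕ} (h : r.bits.length ≤ i) : r.testBit i = false := by
  rw [Nat.testBit_eq_inth, List.getI_eq_default _ h]
  rfl

theorem length_bits_le {r t : ℕ} (h : r < 2 ^ t) : r.bits.length ≤ t := by
  rw [Nat.size_eq_bits_len]
  exact Nat.size_le.2 h

theorem sum_testBit {r t : ℕ} (h : r < 2 ^ t) :
    ∑ i ∈ Finset.range t, (r.testBit i).toNat * 2 ^ i = r := by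
  have key : ∀ t, ∑ i ∈ Finset.range t, (r.testBit i).toNat * 2 ^ i = r % 2 ^ t := by
    intro t
    induction t with
    | zero => simp [Nat.mod_one]
    | succ t ih =>
      rw [Finset.sum_range_succ, ih, Nat.mod_pow_succ, Nat.toNat_testBit]
      ring
  rw [key, Nat.mod_eq_of_lt h]

/-- `Nat.bits` ends with its highest nonzero digit. When digits are produced from the lowest on, the
output length must therefore become `t + 1` at a digit `1` and stay unchanged at a digit `0`. -/
theorem size_mod_two_pow_succ (r t : ℕ) :
    (r % 2 ^ (t + 1)).size = if r.testBit t then t + 1 else (r % 2 ^ t).size := by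
  have h1 : r % 2 ^ (t + 1) = r % 2 ^ t + 2 ^ t * (r.testBit t).toNat := by
    rw [Nat.mod_pow_succ, Nat.toNat_testBit]
  split
  · next h =>
    refine le_antisymm (Nat.size_le.2 (Nat.mod_lt _ (by positivity))) (Nat.lt_size.2 ?_)
    rw [h1, h]
    simp
  · next h => simp [h1, h]

/-! ### Subtraction of unnormalised binary expansions. -/

/-- The carries in the subtraction of two numbers whose digits at `2 ^ t` are `P t` and `Q t`. -/
def carry (P Q : ℕ → ℕ) : ℕ → ℕ × ℕ
  | 0 => (0, 0)
  | t + 1 =>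
    (((carry P Q t).1 + P t) / 2, ((carry P Q t).2 + Q t +
      ((carry P Q t).1 + P t + ((carry P Q t).2 + Q t)) % 2) / 2)

/-- Halving at each step keeps the carries below the bound on the digits: both `(M + M) / 2` and `(M
+ M + 1) / 2` are at most `M`. So carries fit into words. -/
theorem carry_le {P Q : ℕ → ℕ} {M : ℕ} (hP : ∀ t, P t ≤ M) (hQ : ∀ t, Q t ≤ M) (t : ℕ) :
    (carry P Q t).1 ≤ M ∧ (carry P Q t).2 ≤ M := by
  induction t with
  | zero => simp [carry]
  | succ t ih =>
    have h1 := hP t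
    have h2 := hQ t
    simp only [carry]
    omega

/-- The invariant `key` says that `r / 2 ^ t` is the difference of the two carries plus the
contribution `tail t` of the digits from `t` on. Its parity is that of the sum of both carries and
digits at `t`. Adding this bit to the negative part gives both parts the same parity, so the two
halvings lose the same amount; two carries avoid negative words. -/
theorem testBit_eq_carry {P Q : ℕ → ℕ} {T r : ℕ}
    (h : ∑ t ∈ Finset.range T, ((P t : ℤ) - Q t) * 2 ^ t = r) {t : ℕ} (ht : t < T) :
    ((carry P Q t).1 + P t + ((carry P Q t).2 + Q t)) % 2 = (r.testBit t).toNat := by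
  let tail : ℕ → ℤ := fun t => ∑ i ∈ Finset.range (T - t), ((P (t + i) : ℤ) - Q (t + i)) * 2 ^ i
  have htail : ∀ t < T, tail t = P t - Q t + 2 * tail (t + 1) := by
    intro t ht
    simp only [tail]
    rw [show T - t = T - (t + 1) + 1 by omega, Finset.sum_range_succ', Finset.mul_sum]
    rw [add_comm]
    congr 1
    · simp
    · refine Finset.sum_congr rfl fun i _ => ?_
      rw [show t + 1 + i = t + (i + 1) by ring]
      ring
  have key : ∀ t ≤ T, ((r / 2 ^ t : ℕ) : ℤ) = (carry P Q t).1 - (carry P Q t).2 + tail t := by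
    intro t
    induction t with
    | zero => intro _; simp [carry, tail, ← h]
    | succ t ih =>
      intro ht
      have h1 := ih (by omega)
      have h2 := htail t (by omega)
      rw [pow_succ, ← Nat.div_div_eq_div_mul]
      simp only [carry]
      omega
  have h1 := key t ht.le
  have h2 := htail t ht
  rw [Nat.toNat_testBit]
  omega

/-! ## Hardness: the oracle program -/

namespace Selector

/-- The binary digit of the mask in register `8` at the position given by `e`. -/
def groupBit (e : Expr) : Expr := .op .land (.op .shr (.var 8) e) (.const 1)

/-- Whether the left vertex in registers `12`, `13` and the right vertex in registers `14`, `15` are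
adjacent. -/
def conflictExpr : Expr :=
  .op .sub (.const 1) (.op .add (.op .add
    (.op .mul (.op .eq (.var 12) (.var 14)) (.op .eq (.var 13) (.var 15)))
    (.op .mul (.op .lt (.var 12) (.var 14)) (.op .mul (.op .lt (.var 13) (.var 15))
      (.load 0 (.op .add (.var 2) (.op .add (.op .mul (.var 13) (.var 3)) (.var 15)))))))
    (.op .lt (.var 14) (.var 12)))

/-- Write the instance for the mask in register `8` into array `10`. -/
def queryProg : Prog :=
  .seq (upto 12 4 (cond 13 (groupBit (.var 12)) (upto 13 3 (emit 10 14 (.const 1))) .skip))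
    (.seq (emit 10 12 (.const 0))
      (.seq (upto 12 4 (cond 13 (groupBit (.op .add (.var 4) (.var 12)))
          (upto 13 3 (emit 10 14 (.const 1))) .skip))
        (.seq (emit 10 12 (.const 0)) (.seq (upto 12 5 (emit 10 13 (.const 1)))
          (.seq (emit 10 12 (.const 0))
            (upto 12 4 (cond 13 (groupBit (.var 12)) (upto 13 3 (upto 14 4
              (cond 15 (groupBit (.op .add (.var 4) (.var 14)))
                (upto 15 3 (emit 10 16 conflictExpr)) .skip))) .skip)))))))

theorem land_shiftRight_one (m i : ℕ) : m >>> i &&& 1 = (m.testBit i).toNat := by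
  rw [Nat.and_one_is_mod, Nat.shiftRight_eq_div_pow, Nat.toNat_testBit]

section

variable {W : ℕ} {O : Oracle} {s : State} {m : ℕ}

theorem groupBit_spec {e : Expr} {i : ℕ} (hm : s.reg 8 = m) (hmW : m ≤ W) (hW : 1 ≤ W)
    (hf : e.Fits W s) (hv : e.eval s = i) :
    (groupBit e).Fits W s ∧ (groupBit e).eval s = (m.testBit i).toNat := by
  have h1 : (groupBit e).eval s = (m.testBit i).toNat := by
    simp only [groupBit, Expr.eval, Op.eval, hm, hv, land_shiftRight_one]
  refine ⟨⟨⟨?_, hf, ?_⟩, hW, ?_⟩, h1⟩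
  · simpa [Expr.Fits, hm] using hmW
  · simp only [Expr.eval, Op.eval, hm, hv]
    exact (Nat.shiftRight_le _ _).trans hmW
  · have := (Bool.toNat_le (m.testBit i)).trans hW
    rw [← h1] at this
    exact this

theorem emits_group {A d : ℕ} {p : Prog} {e : Expr} {i T : ℕ} {l : List Bool} (hd : 8 < d)
    (hA : 8 ≠ A) (hb : e.Below d) (hm : s.reg 8 = m) (hmW : m ≤ W) (hW : 1 ≤ W)
    (he : ∀ l0, e.Fits W (s.write A A l0) ∧ e.eval (s.write A A l0) = i) (hT : 1 ≤ T)
    (hp : Emits W O A d p s T l) :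
    Emits W O A d (cond d (groupBit e) p .skip) s ((groupBit e).cost + (T + 1))
      (if m.testBit i then l else []) := by
  refine Emits.cond ⟨⟨hd, hb⟩, trivial⟩ (fun l0 _ => ?_) (fun _ => hp)
    (fun _ => Emits.skip.mono hT)
  obtain ⟨h1, h2⟩ := groupBit_spec (s := s.write A A l0) (i := i) (by simp [hA, hm]) hmW hW
    (he l0).1 (he l0).2
  refine ⟨h1, ?_⟩
  rw [h2]
  cases m.testBit i <;> simp

open Classical in
-- The three alternatives in `Compatible` exclude each other, so the sum of their indicators is `0`
-- or `1`, and subtracting it from `1` negates it.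
theorem emits_conflict {A : ℕ → ℕ → Prop} {n p i u j v : ℕ} (hp : s.reg 2 = p) (hn : s.reg 3 = n)
    (hi : s.reg 12 = i) (hu : s.reg 13 = u) (hj : s.reg 14 = j) (hv : s.reg 15 = v)
    (hA : ∀ u < n, ∀ v < n, s.mem 0 (p + (u * n + v)) = (decide (A u v)).toNat)
    (hun : u < n) (hvn : v < n) (hiW : i ≤ W) (hjW : j ≤ W) (hpW : p + n * n ≤ W) :
    Emits W O 10 16 (emit 10 16 conflictExpr) s 40 [decide (Conflict A (i, u) (j, v))] := by
  have hm := mul_add_lt_mul hun hvn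
  have hnW : n ≤ n * n := Nat.le_mul_self n
  refine (Emits.emit (by omega) (by simp [Expr.Below, conflictExpr]) fun l0 _ => ?_).mono
    (by simp only [Expr.cost, conflictExpr]; omega)
  have hload : (s.write 10 10 l0).mem 0 (p + (u * n + v)) = (decide (A u v)).toNat := by
    simp [hA u hun v hvn]
  have r : ∀ x, x ≠ 10 → (s.write 10 10 l0).reg x = s.reg x := fun x hx => by simp [hx]
  simp only [conflictExpr, Expr.Fits, Expr.eval, Op.eval, r 2 (by omega), r 3 (by omega),
    r 12 (by omega), r 13 (by omega), r 14 (by omega), r 15 (by omega), hp, hn, hi, hu, hj, hv,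
    hload, Conflict, Compatible]
  have hm' := mul_add_lt_mul hvn hvn
  -- All order relations are listed with their truth values in each case, so that `simp` can
  -- evaluate every comparison in the expression.
  have c1 : (i < j ∧ i ≠ j ∧ ¬ j < i) ∨ (¬ i < j ∧ i = j ∧ ¬ j < i) ∨
      (¬ i < j ∧ i ≠ j ∧ j < i) := by omega
  have c2 : (u < v ∧ u ≠ v) ∨ (¬ u < v ∧ u = v) ∨ (¬ u < v ∧ u ≠ v) := by omega
  rcases c1 with ⟨h1, h2, h3⟩ | ⟨h1, h2, h3⟩ | ⟨h1, h2, h3⟩ <;>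
    rcases c2 with ⟨h4, h5⟩ | ⟨h4, h5⟩ | ⟨h4, h5⟩ <;>
    by_cases h6 : A u v <;>
    simp [h1, h2, h3, h4, h5, h6] <;> omega

end

/-- The number of vertices is written in unary group by group, without being computed. -/
theorem replicate_length_groups (k n : ℕ) (c : ℕ → Bool) :
    (List.range k).flatMap (fun i => if c i then List.replicate n true else []) =
      List.replicate ((List.range k).flatMap fun i =>
        if c i then (List.range n).map fun u => (i, u) else []).length true := by
  rw [List.eq_replicate_iff]
  constructor
  · simp only [List.length_flatMap]
    congr 2
    funext i
    split <;> simp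
  · intro b hb
    obtain ⟨i, _, hi⟩ := List.mem_flatMap.1 hb
    split at hi
    · exact List.eq_of_mem_replicate hi
    · simp at hi

/-- Row-by-row order of the matrix is the order of four nested loops over `i`, `u`, `j`, `v`, in
which groups outside the mask are skipped. -/
theorem flatMap_vertices (k n m : ℕ) (f : ℕ × ℕ → ℕ × ℕ → Bool) :
    ((leftVertices k n m).flatMap fun x => (rightVertices k n m).map (f x)) =
      (List.range k).flatMap fun i => if m.testBit i then (List.range n).flatMap fun u =>
        (List.range k).flatMap fun j => if m.testBit (k + j) then (List.range n).flatMap fun v =>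
          [f (i, u) (j, v)] else [] else [] := by
  simp only [leftVertices, List.flatMap_assoc]
  congr 1
  funext i
  split
  · simp only [List.flatMap_map, rightVertices, List.map_flatMap]
    congr 1
    funext u
    congr 1
    funext j
    split
    · simp [← List.map_eq_flatMap]
    · rfl
  · rfl

variable {W : ℕ} {O : Oracle} {s : State} {A : ℕ → ℕ → Prop} {k n m p N : ℕ}

open Classical in
theorem emits_queryProg (hp : s.reg 2 = p) (hn : s.reg 3 = n) (hk : s.reg 4 = k)
    (hk2 : s.reg 5 = 2 * k) (hm : s.reg 8 = m)
    (hA : ∀ u < n, ∀ v < n, s.mem 0 (p + (u * n + v)) = (decide (A u v)).toNat)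
    (hW : 1 ≤ W) (hmW : m ≤ W) (hkW : 2 * k ≤ W) (hpW : p + n * n ≤ W)
    (hN : 1 ≤ N) (hnN : n ≤ N) (hkN : k ≤ N) :
    Emits W O 10 12 queryProg s (300 * N ^ 4) (countSizeBIS.encode (maskInstance A k n m)) := by
  have hnW : n ≤ W := (Nat.le_mul_self n).trans (by omega)
  have left : Emits W O 10 12 (upto 12 4 (cond 13 (groupBit (.var 12))
      (upto 13 3 (emit 10 14 (.const 1))) .skip)) s _ _ :=
    Emits.upto (by omega) (by omega) (by omega) (by omega) hW hk fun i hi s1 a1 v1 =>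
      emits_group (i := i) (by omega) (by omega) (by simp [Expr.Below])
        ((a1 8 (by omega)).1.trans hm) hmW hW
        (fun l0 => by simp [Expr.Fits, Expr.eval, v1]; omega)
        (by omega) (emits_ones (by omega) (by omega) (by omega) hnW hW
          ((a1 3 (by omega)).1.trans hn))
  have right : Emits W O 10 12 (upto 12 4 (cond 13 (groupBit (.op .add (.var 4) (.var 12)))
      (upto 13 3 (emit 10 14 (.const 1))) .skip)) s _ _ :=
    Emits.upto (by omega) (by omega) (by omega) (by omega) hW hk fun j hj s1 a1 v1 =>
      emits_group (i := k + j) (by omega) (by omega) (by simp [Expr.Below])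
        ((a1 8 (by omega)).1.trans hm) hmW hW
        (fun l0 => by
          have h4 := (a1 4 (by omega)).1.trans hk
          simp [Expr.Fits, Expr.eval, Op.eval, v1, h4]; omega)
        (by omega) (emits_ones (by omega) (by omega) (by omega) hnW hW
          ((a1 3 (by omega)).1.trans hn))
  have matrix : Emits W O 10 12 (upto 12 4 (cond 13 (groupBit (.var 12)) (upto 13 3 (upto 14 4
      (cond 15 (groupBit (.op .add (.var 4) (.var 14)))
        (upto 15 3 (emit 10 16 conflictExpr)) .skip))) .skip)) s _ _ :=
    Emits.upto (by omega) (by omega) (by omega) (by omega) hW hk fun i hi s1 a1 v1 =>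
      emits_group (i := i) (by omega) (by omega) (by simp [Expr.Below])
        ((a1 8 (by omega)).1.trans hm) hmW hW
        (fun l0 => by simp [Expr.Fits, Expr.eval, v1]; omega) (by omega)
        (Emits.upto (by omega) (by omega) (by omega) hnW hW ((a1 3 (by omega)).1.trans hn)
          fun u hu s2 a2 v2 =>
          Emits.upto (by omega) (by omega) (by omega) (by omega) hW
            (((a2 4 (by omega)).1.trans (a1 4 (by omega)).1).trans hk) fun j hj s3 a3 v3 =>
            emits_group (i := k + j) (by omega) (by omega) (by simp [Expr.Below])
              ((((a3 8 (by omega)).1.trans (a2 8 (by omega)).1).trans (a1 8 (by omega)).1).trans hm)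
              hmW hW
              (fun l0 => by
                have h4 := (((a3 4 (by omega)).1.trans (a2 4 (by omega)).1).trans
                  (a1 4 (by omega)).1).trans hk
                simp [Expr.Fits, Expr.eval, Op.eval, v3, h4]; omega)
              (by omega)
              (Emits.upto (by omega) (by omega) (by omega) hnW hW
                ((((a3 3 (by omega)).1.trans (a2 3 (by omega)).1).trans (a1 3 (by omega)).1).trans
                  hn) fun v hv s4 a4 v4 => by
                have b3 : s4.Agree 14 s2 := (a4.mono (by omega)).trans a3
                have b2 : s4.Agree 13 s1 := (b3.mono (by omega)).trans a2
                have b1 : s4.Agree 12 s := (b2.mono (by omega)).trans a1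
                exact emits_conflict (A := A) ((b1 2 (by omega)).1.trans hp)
                  ((b1 3 (by omega)).1.trans hn)
                  ((b2 12 (by omega)).1.trans v1) ((b3 13 (by omega)).1.trans v2)
                  ((a4 14 (by omega)).1.trans v3) v4
                  (by rw [(b1 0 (by omega)).2]; exact hA) hu hv (by omega) (by omega) hpW))
  have main := left.seq <| (emits_bit (by omega) hW false).seq <| right.seq <|
    (emits_bit (by omega) hW false).seq <|
    (emits_ones (d := 12) (x := 5) (by omega) (by omega) (by omega) hkW hW hk2).seq <|
    (emits_bit (by omega) hW false).seq matrix
  have hl : countSizeBIS.encode (maskInstance A k n m) = _ :=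
    encode_maskInstance.trans (congrArg (fun l => unaryThen _ (unaryThen _ (unaryThen _ l)))
      (flatMap_vertices k n m fun x y => decide (Conflict A x y)))
  rw [hl]
  simp only [unaryThen, leftVertices, rightVertices]
  rw [← replicate_length_groups k n fun i => m.testBit i,
    ← replicate_length_groups k n fun j => m.testBit (k + j)]
  refine Emits.mono main ?_
  simp only [groupBit, Expr.cost]
  -- The time is a polynomial in `k` and `n` whose highest monomial `k * n * k * n` comes from the
  -- four nested loops; each monomial is bounded by `N ^ 4`.
  have f0 : 1 ≤ N ^ 4 := Nat.one_le_pow _ _ hN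
  have f1 : k ≤ N ^ 4 := hkN.trans (Nat.le_self_pow (by omega) N)
  have f2 : k * n ≤ N ^ 2 := by rw [pow_two]; exact Nat.mul_le_mul hkN hnN
  have f3 : k * n * k ≤ N ^ 3 := by rw [pow_succ N 2]; exact Nat.mul_le_mul f2 hkN
  have f4 : k * n * k * n ≤ N ^ 4 := by rw [pow_succ N 3]; exact Nat.mul_le_mul f3 hnN
  have f5 : N ^ 2 ≤ N ^ 4 := Nat.pow_le_pow_right hN (by omega)
  have f6 : N ^ 3 ≤ N ^ 4 := Nat.pow_le_pow_right hN (by omega)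
  ring_nf at *
  omega

/-! ### Processing the masks and accumulating the digits of the answers. -/

/-- Compute into register `9` the parity of the number of groups in the mask in register `8`. -/
def parityProg : Prog :=
  .seq (assign 12 9 (.const 0)) (upto 12 5 (assign 13 9
    (.op .mod (.op .add (.var 9) (groupBit (.var 12))) (.const 2))))

theorem run_parityProg {K : ℕ} (hk2 : s.reg 5 = K) (hm : s.reg 8 = m) (hW : 2 ≤ W) (hmW : m ≤ W)
    (hKW : K ≤ W) :
    Run W O 12 parityProg s (K * 15 + 5) (s.setReg 9 (bitSum K m % 2)) := by
  have loop := Run.upto (W := W) (O := O) (d := 12) (x := 5) (n := K) (T := 11)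
    (p := assign 13 9 (.op .mod (.op .add (.var 9) (groupBit (.var 12))) (.const 2)))
    (σ := fun j => s.setReg 9 (bitSum j m % 2)) (by omega) hKW (by omega) (fun j _ => by simp [hk2])
    (fun j hj s1 a1 v1 => ?_)
  · refine ((Run.assign (x := 9) (e := .const 0) trivial (Nat.zero_le _) (Nat.zero_le _)).seq
      (loop.congr ?_ (State.Agree.refl _ _))).mono ?_
    · simp [Expr.eval, bitSum, State.Agree.refl]
    · simp only [Expr.cost]; omega
  · have h9 : s1.reg 9 = bitSum j m % 2 := by simpa using (a1 9 (by omega)).1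
    have h8 : s1.reg 8 = m := by simpa [hm] using (a1 8 (by omega)).1
    obtain ⟨g1, g2⟩ := groupBit_spec (W := W) (s := s1) (e := .var 12) (i := j) h8 hmW (by omega)
      (by simp only [Expr.Fits]; omega) v1
    have hle := Bool.toNat_le (m.testBit j)
    have hsum : bitSum (j + 1) m = bitSum j m + (m.testBit j).toNat := by
      simp [bitSum, Finset.sum_range_succ]
    have hv : Expr.eval (.op .mod (.op .add (.var 9) (groupBit (.var 12))) (.const 2)) s1 =
        bitSum (j + 1) m % 2 := by
      simp only [Expr.eval, Op.eval, g2, h9, hsum]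
      omega
    refine ⟨s1.setReg 9 (bitSum (j + 1) m % 2), ?_, by simp [v1], ?_⟩
    · intro x hx
      have := a1 x hx
      by_cases hx9 : x = 9 <;> simp_all
    · have hfit : Expr.Fits W s1
          (.op .mod (.op .add (.var 9) (groupBit (.var 12))) (.const 2)) := by
        refine ⟨⟨?_, g1, ?_⟩, hW, ?_⟩
        · simp only [Expr.Fits]; omega
        · simp only [Expr.eval, Op.eval, g2, h9]; omega
        · exact hv.trans_le (by omega)
      rw [← hv]
      exact (Run.assign (by simp [Expr.Below, groupBit]) hfit (by omega)).mono
        (by simp [Expr.cost, groupBit])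

/-- The position in array `2` of the digit with index register `12` of the sum for the parity in
register `9`. -/
def digitIndex : Expr := .op .add (.op .mul (.const 2) (.var 12)) (.var 9)

/-- Add the digits of the answer in array `11` to those in array `2`. -/
def addAnswerProg : Prog :=
  upto 12 11 (put 13 2 digitIndex (.op .add (.load 2 digitIndex) (.load 11 (.var 12))))

/-- The digits of the answer are added without carrying, since the number itself need not fit into a
word. Turn `t` touches position `2 * t + b` only, and entries strictly below `W` leave room for the
increment. -/
theorem run_addAnswerProg {r b : ℕ} (hr : s.Holds 11 11 r.bits) (hb : s.reg 9 = b) (hb2 : b < 2)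
    (hW : 2 * r.bits.length + 2 ≤ W) (hM : ∀ i, s.mem 2 i < W) :
    Run W O 12 addAnswerProg s (r.bits.length * 30 + 3) (s.setArray 2 fun i =>
      s.mem 2 i + if i % 2 = b then (r.testBit (i / 2)).toNat else 0) := by
  have loop := Run.upto (W := W) (O := O) (d := 12) (x := 11) (n := r.bits.length) (T := 26)
    (p := put 13 2 digitIndex (.op .add (.load 2 digitIndex) (.load 11 (.var 12))))
    (σ := fun t => s.setArray 2 fun i => s.mem 2 i +
      if i % 2 = b ∧ i / 2 < t then (r.testBit (i / 2)).toNat else 0)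
    (by omega) (by omega) (by omega) (fun j _ => by simpa using hr.1) (fun t ht s1 a1 v1 => ?_)
  · refine loop.congr ?_ ?_
    · simpa [State.setArray] using State.Agree.refl _ s
    · intro x hx
      refine ⟨rfl, ?_⟩
      by_cases hx2 : x = 2
      · subst hx2
        simp only [State.setArray_mem, if_true]
        funext i
        by_cases hi : i / 2 < r.bits.length
        · simp [hi]
        · simp [hi, testBit_of_size_le (not_lt.1 hi)]
      · simp [hx2]
  · have h9 : s1.reg 9 = b := by simpa [hb] using (a1 9 (by omega)).1
    have h2 : s1.mem 2 = fun i => s.mem 2 i +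
      if i % 2 = b ∧ i / 2 < t then (r.testBit (i / 2)).toNat else 0 := by
      simpa using (a1 2 (by omega)).2
    have h11 : s1.mem 11 t = (r.testBit t).toNat := by
      rw [(a1 11 (by omega)).2]
      simp only [State.setArray_mem, Nat.reduceEqDiff, if_false]
      rw [hr.2 t ht, getElem_bits]
    have hidx : digitIndex.eval s1 = 2 * t + b := by
      simp [digitIndex, Expr.eval, Op.eval, v1, h9]
    have hfit : digitIndex.Fits W s1 := by
      simp [digitIndex, Expr.Fits, Expr.eval, Op.eval, v1, h9]
      omega
    have h2t : s1.mem 2 (2 * t + b) = s.mem 2 (2 * t + b) := by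
      rw [h2]
      simp only [show ¬ (2 * t + b) / 2 < t by omega, and_false, if_false, add_zero]
    have hMt := hM (2 * t + b)
    have hle := Bool.toNat_le (r.testBit t)
    refine ⟨s1.setMem 2 (2 * t + b) (s.mem 2 (2 * t + b) + (r.testBit t).toNat), ?_,
      by simp [v1], ?_⟩
    · intro x hx
      refine ⟨by simpa using (a1 x hx).1, ?_⟩
      by_cases hx2 : x = 2
      · subst hx2
        simp only [State.setMem_mem, if_true, h2, State.setArray_mem]
        funext i
        by_cases hi : i = 2 * t + b
        · rw [if_pos hi, if_pos (by omega), hi, show (2 * t + b) / 2 = t by omega]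
        · rw [if_neg hi]
          congr 1
          refine if_congr ?_ rfl rfl
          omega
      · simpa [hx2] using (a1 x hx).2
    · have := Run.put (W := W) (O := O) (s := s1) (d := 13) (a := 2) (e := digitIndex)
        (e' := .op .add (.load 2 digitIndex) (.load 11 (.var 12)))
        (by simp [Expr.Below, digitIndex]) (by simp [Expr.Below, digitIndex]) hfit
        ⟨hfit, by simp only [Expr.Fits]; omega, by
          simp only [Expr.eval, Op.eval, hidx, h2t, v1, h11]; omega⟩
      simp only [Expr.eval, Op.eval, hidx, h2t, v1, h11] at this
      exact this.mono (by simp [Expr.cost, digitIndex])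

/-- Ask for the number of independent sets belonging to the mask in register `8`, and add it to the
sum for the parity of the mask. -/
def maskProg : Prog :=
  .seq parityProg (.seq (assign 12 10 (.const 0)) (.seq queryProg
    (.seq (.query 10 10 11 11) addAnswerProg)))

/-- The contribution of the mask `m` to position `i` of array `2`. -/
noncomputable def digit (A : ℕ → ℕ → Prop) (k n m i : ℕ) : ℕ :=
  if i % 2 = bitSum (2 * k) m % 2 then ((maskCount A k n m).testBit (i / 2)).toNat else 0

theorem digit_le_one (A : ℕ → ℕ → Prop) (k n m i : ℕ) : digit A k n m i ≤ 1 := by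
  unfold digit
  split
  · exact Bool.toNat_le _
  · exact zero_le_one

theorem length_encode_maskInstance_le :
    (countSizeBIS.encode (maskInstance A k n m)).length ≤
      2 * (k * n) + 2 * k + 3 + (k * n) * (k * n) := by
  have h1 := length_leftVertices_le (k := k) (n := n) (m := m)
  have h2 := length_rightVertices_le (k := k) (n := n) (m := m)
  have h3 := Nat.mul_le_mul h1 h2
  simp only [countSizeBIS, BISInstance.encode, length_unaryThen, length_matrixBits, maskInstance]
  omega

theorem length_bits_maskCount_le : (maskCount A k n m).bits.length ≤ 2 * (k * n) + 1 := by
  refine length_bits_le ?_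
  have := maskCount_le (A := A) (k := k) (n := n) (m := m)
  rw [pow_succ, ← mul_assoc]
  have h2 : 0 < 2 ^ (2 * k * n) := by positivity
  omega

theorem mul_self_bounds (hN : 1 ≤ N) (hnN : n ≤ N) (hkN : k ≤ N) :
    1 ≤ N ^ 4 ∧ N ≤ N ^ 4 ∧ k * n ≤ N ^ 4 ∧ n * n ≤ N ^ 4 ∧ (k * n) * (k * n) ≤ N ^ 4 := by
  have h2 : N * N ≤ N ^ 4 := by
    rw [← pow_two]; exact Nat.pow_le_pow_right hN (by omega)
  refine ⟨Nat.one_le_pow _ _ hN, Nat.le_self_pow (by omega) N,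
    (Nat.mul_le_mul hkN hnN).trans h2, (Nat.mul_le_mul hnN hnN).trans h2, ?_⟩
  calc (k * n) * (k * n) ≤ (N * N) * (N * N) :=
        Nat.mul_le_mul (Nat.mul_le_mul hkN hnN) (Nat.mul_le_mul hkN hnN)
    _ = N ^ 4 := by ring

open Classical in
theorem run_maskProg {K : ℕ} (hp : s.reg 2 = p) (hn : s.reg 3 = n) (hk : s.reg 4 = k)
    (hk2 : s.reg 5 = 2 * k) (hm : s.reg 8 = m)
    (hA : ∀ u < n, ∀ v < n, s.mem 0 (p + (u * n + v)) = (decide (A u v)).toNat)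
    (hM : ∀ i, s.mem 2 i < W) (hK : 2 * k ≤ K) (hmW : m ≤ W) (hpW : p + n * n ≤ W)
    (hN : 1 ≤ N) (hnN : n ≤ N) (hkN : k ≤ N) (hW : 100 * N ^ 4 ≤ W) :
    ∃ s', Run W (countSizeBIS.oracle K) 12 maskProg s (500 * N ^ 4) s' ∧
      s'.Agree 9 (s.setArray 2 fun i => s.mem 2 i + digit A k n m i) := by
  obtain ⟨b0, b1, b2, b3, b4⟩ := mul_self_bounds hN hnN hkN
  have hq := length_encode_maskInstance_le (A := A) (k := k) (n := n) (m := m)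
  have hr := length_bits_maskCount_le (A := A) (k := k) (n := n) (m := m)
  set q := countSizeBIS.encode (maskInstance A k n m) with hq_def
  set r := maskCount A k n m with hr_def
  let s1 := s.setReg 9 (bitSum (2 * k) m % 2)
  have r1 : Run W (countSizeBIS.oracle K) 12 parityProg s (2 * k * 15 + 5) s1 :=
    run_parityProg hk2 hm (by omega) hmW (by omega)
  -- Resetting the length empties array `10`; entries left over from an earlier query lie beyond the
  -- new length or are overwritten.
  have r2 : Run W (countSizeBIS.oracle K) 12 (assign 12 10 (.const 0)) s1 2
      (s1.setReg 10 0) := Run.assign (e := .const 0) trivial (Nat.zero_le _) (Nat.zero_le _)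
  have r3 : Run W (countSizeBIS.oracle K) 12 queryProg (s1.setReg 10 0) (300 * N ^ 4)
      (s1.write 10 10 q) := by
    refine (emits_queryProg (s := s1) (A := A) (k := k) (n := n) (m := m) (by simp [s1, hp])
      (by simp [s1, hn]) (by simp [s1, hk]) (by simp [s1, hk2]) (by simp [s1, hm])
      (by simpa [s1] using hA) (by omega) hmW (by omega) hpW hN hnN hkN [] ?_).congr ?_
      (State.Agree.refl _ _)
    · rw [List.length_nil, Nat.zero_add, ← hq_def]; omega
    · intro x hx
      by_cases h : x = 10 <;> simp [h]
  have r4 : Run W (countSizeBIS.oracle K) 12 (.query 10 10 11 11) (s1.write 10 10 q)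
      (q.length + r.bits.length + 1) ((s1.write 10 10 q).write 11 11 r.bits) :=
    Run.query (by omega) (by omega) (State.holds_write _ _ _ _)
      ⟨maskInstance A k n m, rfl, hK, by rw [count_maskInstance]⟩ (by omega)
  have r5 := run_addAnswerProg (W := W) (O := countSizeBIS.oracle K)
    (s := (s1.write 10 10 q).write 11 11 r.bits) (b := bitSum (2 * k) m % 2)
    (State.holds_write _ _ _ _) (by simp [s1]) (Nat.mod_lt _ two_pos) (by omega)
    (by simpa [s1] using hM)
  refine ⟨_, (r1.seq (r2.seq (r3.seq (r4.seq r5)))).mono ?_, ?_⟩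
  · omega
  · intro x hx
    have h9 : x ≠ 9 := by omega
    have h10 : x ≠ 10 := by omega
    have h11 : x ≠ 11 := by omega
    refine ⟨by simp [s1, h9, h10, h11], ?_⟩
    by_cases hx2 : x = 2
    · subst hx2
      simp only [State.setArray_mem, if_true, State.write_mem, Nat.reduceEqDiff, if_false, s1,
        State.setReg_mem, digit, hr_def]
    · simp [s1, hx2, h10, h11]

/-- The contents of array `2` after the masks below `m`. -/
noncomputable def digitSum (A : ℕ → ℕ → Prop) (k n m i : ℕ) : ℕ :=
  ∑ m' ∈ Finset.range m, digit A k n m' i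

/-- A mask adds at most one to each entry, so the entries never exceed the number of masks and fit
into words without carrying. -/
theorem digitSum_le (A : ℕ → ℕ → Prop) (k n m i : ℕ) : digitSum A k n m i ≤ m := by
  refine (Finset.sum_le_card_nsmul _ _ 1 fun m' _ => digit_le_one A k n m' i).trans ?_
  simp

open Classical in
theorem run_allMasks {K M : ℕ} (hp : s.reg 2 = p) (hn : s.reg 3 = n) (hk : s.reg 4 = k)
    (hk2 : s.reg 5 = 2 * k) (hM : s.reg 6 = M)
    (hA : ∀ u < n, ∀ v < n, s.mem 0 (p + (u * n + v)) = (decide (A u v)).toNat)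
    (h0 : s.mem 2 = fun _ => 0) (hK : 2 * k ≤ K) (hMW : M < W) (hpW : p + n * n ≤ W)
    (hN : 1 ≤ N) (hnN : n ≤ N) (hkN : k ≤ N) (hW : 100 * N ^ 4 ≤ W) :
    Run W (countSizeBIS.oracle K) 8 (upto 8 6 maskProg) s (M * (500 * N ^ 4 + 4) + 3)
      (s.setArray 2 (digitSum A k n M)) := by
  have loop := Run.upto (W := W) (O := countSizeBIS.oracle K) (d := 8) (x := 6) (n := M)
    (p := maskProg) (T := 500 * N ^ 4) (σ := fun m => s.setArray 2 (digitSum A k n m)) (by omega)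
    hMW.le (by omega) (fun j _ => hM) (fun m hm s1 a1 v1 => ?_)
  · refine loop.congr (fun x hx => ⟨rfl, ?_⟩) (State.Agree.refl _ _)
    by_cases hx2 : x = 2
    · subst hx2
      rw [h0]
      funext i
      simp [digitSum]
    · simp [hx2]
  · have h2 : s1.mem 2 = digitSum A k n m := by simpa using (a1 2 (by omega)).2
    refine ⟨s1.setArray 2 (digitSum A k n (m + 1)), ?_, v1, ?_⟩
    · intro x hx
      refine ⟨(a1 x hx).1, ?_⟩
      by_cases hx2 : x = 2
      · simp [hx2]
      · simpa [hx2] using (a1 x hx).2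
    -- The loop runs its body at bound `9`, but `maskProg` also uses the registers and arrays `9`,
    -- `10`, `11` and is verified at bound `12`; their initial contents do not matter.
    · refine Run.lower (by omega : 9 ≤ 12) fun s2 a2 => ?_
      have a2' : s2.Agree 8 (s.setArray 2 (digitSum A k n m)) := (a2.mono (by omega)).trans a1
      have e2 : s2.mem 2 = digitSum A k n m := by simpa using (a2' 2 (by omega)).2
      obtain ⟨s', hs', as'⟩ := run_maskProg (s := s2) (A := A) (k := k) (n := n) (m := m) (p := p)
        (N := N) (W := W) (K := K)
        ((a2' 2 (by omega)).1.trans hp) ((a2' 3 (by omega)).1.trans hn)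
        ((a2' 4 (by omega)).1.trans hk) ((a2' 5 (by omega)).1.trans hk2)
        ((a2 8 (by omega)).1.trans v1)
        (by rw [(a2' 0 (by omega)).2]; simpa using hA)
        (fun i => by rw [e2]; exact ((digitSum_le A k n m i).trans_lt hm).trans hMW) hK
        (by omega) hpW hN hnN hkN hW
      refine ⟨s', as'.trans fun x hx => ⟨(a2 x hx).1, ?_⟩, hs'⟩
      by_cases hx2 : x = 2
      · subst hx2
        simp only [State.setArray_mem, if_true, e2]
        funext i
        simp [digitSum, Finset.sum_range_succ]
      · simpa [hx2] using (a2 x hx).2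

open Classical in
-- Even positions collect the digits for masks of even weight, odd positions those for masks of odd
-- weight. The weighted difference is thus the signed sum in `sum_maskCount`; no digit is lost,
-- because every count is below `2 ^ (2 * k * n + 1)`.
theorem sum_digitSum (G : SimpleGraph (Fin n)) :
    ∑ t ∈ Finset.range (2 * k * n + 1),
      ((digitSum (adjNat G) k n (2 ^ (2 * k)) (2 * t) : ℤ) -
        digitSum (adjNat G) k n (2 ^ (2 * k)) (2 * t + 1)) * 2 ^ t =
      (Set.ncard {s : Finset (Fin n) | G.IsNClique k s} : ℕ) := by
  rw [← card_colourful, ← sum_maskCount]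
  simp only [digitSum, Nat.cast_sum, ← Finset.sum_sub_distrib, Finset.sum_mul]
  rw [Finset.sum_comm]
  refine Finset.sum_congr rfl fun m _ => ?_
  have hlt : maskCount (adjNat G) k n m < 2 ^ (2 * k * n + 1) :=
    maskCount_le.trans_lt (Nat.pow_lt_pow_right one_lt_two (Nat.lt_succ_self _))
  have h := congrArg (Nat.cast (R := ℤ)) (sum_testBit hlt)
  push_cast at h
  rw [← h, Finset.mul_sum]
  refine Finset.sum_congr rfl fun t _ => ?_
  simp only [digit]
  rw [show 2 * t % 2 = 0 by omega, show (2 * t + 1) % 2 = 1 by omega,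
    show 2 * t / 2 = t by omega, show (2 * t + 1) / 2 = t by omega]
  rcases Nat.even_or_odd (bitSum (2 * k) m) with hb | hb
  · rw [hb.neg_one_pow, Nat.even_iff.1 hb]
    simp
  · rw [hb.neg_one_pow, Nat.odd_iff.1 hb]
    simp

/-! ## The final subtraction -/

/-- Compute digit number register `12` of the difference of the two sums in array `2`, with
carries in registers `8` and `9`. -/
def subDigitProg : Prog :=
  .seq (assign 14 8 (.op .add (.var 8) (.load 2 (.op .mul (.const 2) (.var 12)))))
    (.seq (assign 14 9 (.op .add (.var 9)
        (.load 2 (.op .add (.op .mul (.const 2) (.var 12)) (.const 1)))))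
      (.seq (assign 14 13 (.op .mod (.op .add (.var 8) (.var 9)) (.const 2)))
        (.seq (assign 14 8 (.op .div (.var 8) (.const 2)))
          (.seq (assign 14 9 (.op .div (.op .add (.var 9) (.var 13)) (.const 2)))
            (.seq (put 14 1 (.var 12) (.var 13))
              (cond 14 (.var 13) (assign 14 1 (.op .add (.var 12) (.const 1))) .skip))))))

theorem run_subDigitProg {t c c' P Q b : ℕ} (h8 : s.reg 8 = c) (h9 : s.reg 9 = c')
    (h12 : s.reg 12 = t) (hP : s.mem 2 (2 * t) = P) (hQ : s.mem 2 (2 * t + 1) = Q)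
    (hb : (c + P + (c' + Q)) % 2 = b) (hW : c + P + (c' + Q) + 2 ≤ W) (htW : 2 * t + 2 ≤ W) :
    Run W O 14 subDigitProg s 60 (((((s.setReg 13 b).setReg 8 ((c + P) / 2)).setReg 9
      ((c' + Q + b) / 2)).setMem 1 t b).setReg 1 (if b ≠ 0 then t + 1 else s.reg 1)) := by
  have r1 := Run.assign (W := W) (O := O) (d := 14) (s := s) (x := 8)
    (e := .op .add (.var 8) (.load 2 (.op .mul (.const 2) (.var 12)))) (by simp [Expr.Below])
    (by simp [Expr.Fits, Expr.eval, Op.eval, h8, h12, hP]; omega)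
    (by simp [Expr.eval, Op.eval, h8, h12, hP]; omega)
  simp only [Expr.eval, Op.eval, h8, h12, hP] at r1
  have r2 := Run.assign (W := W) (O := O) (d := 14) (s := s.setReg 8 (c + P)) (x := 9)
    (e := .op .add (.var 9) (.load 2 (.op .add (.op .mul (.const 2) (.var 12)) (.const 1))))
    (by simp [Expr.Below])
    (by simp [Expr.Fits, Expr.eval, Op.eval, h9, h12, hQ]; omega)
    (by simp [Expr.eval, Op.eval, h9, h12, hQ]; omega)
  have r3 := Run.assign (W := W) (O := O) (d := 14) (s := (s.setReg 8 (c + P)).setReg 9 (c' + Q))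
    (x := 13) (e := .op .mod (.op .add (.var 8) (.var 9)) (.const 2))
    (by simp [Expr.Below])
    (by simp [Expr.Fits, Expr.eval, Op.eval]; omega)
    (by simp [Expr.eval, Op.eval]; omega)
  have r4 := Run.assign (W := W) (O := O) (d := 14)
    (s := ((s.setReg 8 (c + P)).setReg 9 (c' + Q)).setReg 13 b)
    (x := 8) (e := .op .div (.var 8) (.const 2))
    (by simp [Expr.Below])
    (by simp [Expr.Fits, Expr.eval, Op.eval]; omega)
    (by simp [Expr.eval, Op.eval]; omega)
  have r5 := Run.assign (W := W) (O := O) (d := 14)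
    (s := (((s.setReg 8 (c + P)).setReg 9 (c' + Q)).setReg 13 b).setReg 8 ((c + P) / 2))
    (x := 9) (e := .op .div (.op .add (.var 9) (.var 13)) (.const 2))
    (by simp [Expr.Below])
    (by simp [Expr.Fits, Expr.eval, Op.eval]; omega)
    (by simp [Expr.eval, Op.eval]; omega)
  set s5 := ((((s.setReg 8 (c + P)).setReg 9 (c' + Q)).setReg 13 b).setReg 8
    ((c + P) / 2)).setReg 9 ((c' + Q + b) / 2) with hs5
  have r6 := Run.put (W := W) (O := O) (d := 14) (s := s5) (a := 1) (e := .var 12) (e' := .var 13)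
    (by simp [Expr.Below]) (by simp [Expr.Below]) (by simp [Expr.Fits, hs5, h12]; omega)
    (by simp [Expr.Fits, hs5]; omega)
  have e12 : s5.reg 12 = t := by simp [hs5, h12]
  have e13 : s5.reg 13 = b := by simp [hs5]
  have e1 : s5.reg 1 = s.reg 1 := by simp [hs5]
  simp only [Expr.eval, Op.eval, State.setReg_reg, State.setReg_mem, h9, h12, hQ, hb, e12, e13,
    Nat.reduceEqDiff, if_false, if_true] at r2 r3 r4 r5 r6
  have r7 : Run W O 14 (cond 14 (.var 13) (assign 14 1 (.op .add (.var 12) (.const 1))) .skip)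
      (s5.setMem 1 t b) 6
      ((s5.setMem 1 t b).setReg 1 (if b ≠ 0 then t + 1 else s.reg 1)) := by
    refine (Run.cond (T := 4) (by simp [Expr.Below]) (by simp [Expr.Fits, e13]; omega)
      (fun h => ?_) (fun h => ?_)).mono (by simp [Expr.cost])
    · have hb0 : b ≠ 0 := by simpa [Expr.eval, e13] using h
      have := Run.assign (W := W) (O := O) (d := 14) (s := s5.setMem 1 t b) (x := 1)
        (e := .op .add (.var 12) (.const 1)) (by simp [Expr.Below])
        (by simp [Expr.Fits, Expr.eval, Op.eval, e12]; omega)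
        (by simp [Expr.eval, Op.eval, e12]; omega)
      simp only [Expr.eval, Op.eval, State.setMem_reg, e12] at this
      rw [if_pos hb0]
      exact this.mono (by simp [Expr.cost])
    · have hb0 : b = 0 := by simpa [Expr.eval, e13] using h
      refine (Run.skip.congr (State.Agree.refl _ _) ?_).mono (by omega)
      intro x hx
      by_cases hx1 : x = 1
      · subst hx1; simp [hb0, e1]
      · simp [hx1]
  refine ((r1.seq (r2.seq (r3.seq (r4.seq (r5.seq (r6.seq r7)))))).congr
    (State.Agree.refl _ _) ?_).mono (by simp [Expr.cost])
  intro x hx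
  refine ⟨?_, by simp [hs5]⟩
  simp only [hs5, State.setReg_reg, State.setMem_reg]
  split_ifs <;> simp_all

/-- Write the difference of the two sums in array `2` into array `1`. -/
def subProg : Prog :=
  .seq (assign 12 8 (.const 0)) (.seq (assign 12 9 (.const 0)) (upto 12 7 subDigitProg))

/-- After `t` turns, `σ t` holds the two carries, the lowest `t` digits of `r`, and as output length
the size of `r % 2 ^ t`. The `4 * M` in `hW` covers two carries and two digits, each at most `M`. -/
theorem run_subProg {T M r : ℕ} (h1 : s.reg 1 = 0) (h7 : s.reg 7 = T)
    (hM : ∀ i, s.mem 2 i ≤ M) (hW : 4 * M + 2 ≤ W) (hTW : 2 * T + 2 ≤ W)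
    (hr : ∑ t ∈ Finset.range T, ((s.mem 2 (2 * t) : ℤ) - s.mem 2 (2 * t + 1)) * 2 ^ t = r)
    (hrT : r < 2 ^ T) :
    ∃ s', Run W O 12 subProg s (T * 64 + 10) s' ∧ s'.Holds 1 1 r.bits := by
  let c : ℕ → ℕ × ℕ := carry (fun t => s.mem 2 (2 * t)) (fun t => s.mem 2 (2 * t + 1))
  let σ : ℕ → State := fun t =>
    (((s.setReg 8 (c t).1).setReg 9 (c t).2).setReg 1 (r % 2 ^ t).size).setArray 1
      fun i => if i < t then (r.testBit i).toNat else s.mem 1 i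
  have loop := Run.upto (W := W) (O := O) (d := 12) (x := 7) (n := T) (T := 60)
    (p := subDigitProg) (σ := σ) (by omega) (by omega) (by omega) (fun j _ => by simp [σ, h7])
    (fun t ht s1 a1 v1 => ?_)
  · have r1 := Run.assign (W := W) (O := O) (d := 12) (s := s) (x := 8) (e := .const 0) trivial
      (Nat.zero_le _) (Nat.zero_le _)
    have r2 := Run.assign (W := W) (O := O) (d := 12) (s := s.setReg 8 0) (x := 9) (e := .const 0)
      trivial (Nat.zero_le _) (Nat.zero_le _)
    refine ⟨σ T, (r1.seq (r2.seq (loop.congr ?_ (State.Agree.refl _ _)))).mono ?_, ?_, ?_⟩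
    · intro x hx
      refine ⟨?_, ?_⟩
      · by_cases hx1 : x = 1
        · subst hx1; simp [σ, h1, Nat.mod_one]
        · simp [σ, hx1, c, carry, Expr.eval]
      · by_cases hx1 : x = 1
        · subst hx1; simp [σ]
        · simp [σ, hx1]
    · simp only [Expr.cost]; omega
    · simp [σ, Nat.mod_eq_of_lt hrT, Nat.size_eq_bits_len]
    · intro i hi
      have : i < T := hi.trans_le (length_bits_le hrT)
      simp [σ, this, getElem_bits]
  · have hc := carry_le (fun t => hM (2 * t)) (fun t => hM (2 * t + 1)) t
    have hbit := testBit_eq_carry hr ht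
    have hMt := hM (2 * t)
    have hMt' := hM (2 * t + 1)
    refine ⟨(s1.setReg 8 (((c t).1 + s.mem 2 (2 * t)) / 2)).setReg 9
      (((c t).2 + s.mem 2 (2 * t + 1) + (r.testBit t).toNat) / 2) |>.setMem 1 t
        (r.testBit t).toNat |>.setReg 1
        (if (r.testBit t).toNat ≠ 0 then t + 1 else s1.reg 1), ?_, by simp [v1], ?_⟩
    · intro x hx
      have hx1 := a1 x hx
      refine ⟨?_, ?_⟩
      · by_cases h8 : x = 8
        · subst h8; simp [σ, c, carry]
        by_cases h9 : x = 9
        · subst h9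
          simp only [σ, c, carry, State.setReg_reg, State.setMem_reg, State.setArray_reg,
            Nat.reduceEqDiff, if_false, if_true, hbit]
        by_cases h1 : x = 1
        · subst h1
          have h1' : s1.reg 1 = (r % 2 ^ t).size := by simpa [σ] using hx1.1
          simp only [σ, State.setReg_reg, State.setArray_reg, if_true, size_mod_two_pow_succ, h1']
          cases r.testBit t <;> simp
        · simpa [σ, h8, h9, h1] using hx1.1
      · by_cases h1 : x = 1
        · subst h1
          have h1' : s1.mem 1 = fun i => if i < t then (r.testBit i).toNat else s.mem 1 i := by
            simpa [σ] using hx1.2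
          simp only [σ, State.setReg_mem, State.setMem_mem, State.setArray_mem, if_true, h1']
          funext i
          rcases lt_trichotomy i t with h | h | h
          · simp [h, h.ne, h.trans (Nat.lt_succ_self t)]
          · simp [h]
          · simp [h.ne', h.not_gt, show ¬ i < t + 1 by omega]
        · simpa [σ, h1] using hx1.2
    · refine Run.lower (by omega : 13 ≤ 14) fun s2 a2 => ?_
      have a2' : s2.Agree 12 (σ t) := (a2.mono (by omega)).trans a1
      have e2 : s2.mem 2 = s.mem 2 := by simpa [σ] using (a2' 2 (by omega)).2
      refine ⟨_, ?_, run_subDigitProg (W := W) (O := O) (s := s2) (t := t) (c := (c t).1)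
        (c' := (c t).2)
        (P := s.mem 2 (2 * t)) (Q := s.mem 2 (2 * t + 1)) (b := (r.testBit t).toNat)
        (by simpa [σ] using (a2' 8 (by omega)).1) (by simpa [σ] using (a2' 9 (by omega)).1)
        ((a2 12 (by omega)).1.trans v1)
        (by rw [e2]) (by rw [e2]) hbit (by simp only [c]; omega) (by omega)⟩
      intro x hx
      have hx1 := a2 x hx
      have h13 : x ≠ 13 := by omega
      have h1 := (a2 1 (by omega))
      refine ⟨?_, ?_⟩
      · simp only [State.setReg_reg, State.setMem_reg, h13, if_false, hx1.1, h1.1]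
      · simp only [State.setReg_mem, State.setMem_mem, hx1.2, h1.2]

/-! ### The complete oracle program for cliques. -/

/-- Read the input, and compute twice the parameter, the number of masks and the number of
digits. -/
def setupProg : Prog :=
  .seq (readUnary 8 2 3) (.seq (readUnary 8 2 4) (.seq (assign 8 5 (.op .mul (.const 2) (.var 4)))
    (.seq (assign 8 6 (.op .shl (.const 1) (.var 5)))
      (assign 8 7 (.op .add (.op .mul (.var 5) (.var 3)) (.const 1))))))

/-- Count the cliques of a graph with an oracle for counting independent sets. -/
def cliqueProg : Prog := .seq setupProg (.seq (upto 8 6 maskProg) subProg)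

theorem run_setupProg {W : ℕ} {O : Oracle} {n k : ℕ} {l : List Bool} (hW : n + k + 2 ≤ W)
    (hkW : 2 * k ≤ W) (hM : 2 ^ (2 * k) ≤ W) (hT : 2 * k * n + 1 ≤ W) :
    Run W O 8 setupProg (State.init (unaryThen n (unaryThen k l))) (11 * n + 11 * k + 40)
      (((((((State.init (unaryThen n (unaryThen k l))).setReg 3 n).setReg 4 k).setReg 2
        (n + k + 2)).setReg 5 (2 * k)).setReg 6 (2 ^ (2 * k))).setReg 7 (2 * k * n + 1)) := by
  set s := State.init (unaryThen n (unaryThen k l)) with hs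
  have reg0 : ∀ x, x ≠ 0 → s.reg x = 0 := fun x hx => by simp [hs, State.init, hx]
  have S0 : s.Stores 0 0 _ := State.stores_init _
  have S1 := S0.unary_rest
  have r1 := run_readUnary (W := W) (O := O) (d := 8) (pos := 2) (cnt := 3) (s := s) (p := 0)
    (by omega) (by omega) (by omega) (by simp [reg0]) (by simp [reg0]) S0 (by omega)
  have r2 := run_readUnary (W := W) (O := O) (d := 8) (pos := 2) (cnt := 4)
    (s := (s.setReg 3 n).setReg 2 (0 + n + 1)) (p := 0 + n + 1) (by omega) (by omega)
    (by omega) (by simp) (by simp [reg0]) (S1.of_mem_eq rfl) (by omega)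
  let s2 := ((s.setReg 3 n).setReg 4 k).setReg 2 (n + k + 2)
  have r3 := Run.assign (W := W) (O := O) (d := 8) (s := s2) (x := 5)
    (e := .op .mul (.const 2) (.var 4)) (by simp [Expr.Below])
    (by simp [Expr.Fits, Expr.eval, Op.eval, s2]; omega)
    (by simp [Expr.eval, Op.eval, s2]; omega)
  have r4 := Run.assign (W := W) (O := O) (d := 8) (s := s2.setReg 5 (2 * k)) (x := 6)
    (e := .op .shl (.const 1) (.var 5)) (by simp [Expr.Below])
    (by simp [Expr.Fits, Expr.eval, Op.eval, Nat.one_shiftLeft]; omega)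
    (by simpa [Expr.eval, Op.eval, Nat.one_shiftLeft] using hM)
  have r5 := Run.assign (W := W) (O := O) (d := 8)
    (s := (s2.setReg 5 (2 * k)).setReg 6 (2 ^ (2 * k))) (x := 7)
    (e := .op .add (.op .mul (.var 5) (.var 3)) (.const 1)) (by simp [Expr.Below])
    (by simp [Expr.Fits, Expr.eval, Op.eval, s2]; omega)
    (by simpa [Expr.eval, Op.eval, s2] using hT)
  have e3 : Expr.eval (.op .mul (.const 2) (.var 4)) s2 = 2 * k := by
    simp [Expr.eval, Op.eval, s2]
  have e4 : Expr.eval (.op .shl (.const 1) (.var 5)) (s2.setReg 5 (2 * k)) = 2 ^ (2 * k) := by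
    simp [Expr.eval, Op.eval, Nat.one_shiftLeft]
  have e5 : Expr.eval (.op .add (.op .mul (.var 5) (.var 3)) (.const 1))
      ((s2.setReg 5 (2 * k)).setReg 6 (2 ^ (2 * k))) = 2 * k * n + 1 := by
    simp [Expr.eval, Op.eval, s2]
  rw [e3] at r3
  rw [e4] at r4
  rw [e5] at r5
  refine (r1.seq ((r2.congr (State.Agree.refl _ _) ?_).seq (r3.seq (r4.seq r5)))).mono ?_
  · intro x hx
    refine ⟨?_, rfl⟩
    simp only [s2, State.setReg_reg]
    split_ifs <;> omega
  · simp only [Expr.cost]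
    omega

theorem computesWithin_cliqueProg (x : CliqueInstance) :
    ComputesWithin (1000 * 4 ^ x.k * countCliques.size x ^ 4) (countSizeBIS.oracle (2 * x.k))
      cliqueProg (countCliques.encode x) (countCliques.count x).bits := by
  classical
  have hsize : countCliques.size x = x.n + x.k + x.n * x.n + 3 := by
    simp only [ParamCountingProblem.size, countCliques, CliqueInstance.encode,
      length_unaryThen, length_matrixBits]
    omega
  have hlen : (countCliques.encode x).length + 1 = countCliques.size x := rfl
  obtain ⟨n, G, k, hk⟩ := x
  dsimp only at hsize ⊢
  set N := countCliques.size ⟨n, G, k, hk⟩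
  obtain ⟨b0, b1, b2, b3, b4⟩ := mul_self_bounds (N := N) (n := n) (k := k) (by omega) (by omega)
    (by omega)
  -- There are `4 ^ k` masks at about `500 * N ^ 4` steps each; the rest of the constant absorbs
  -- input reading, loop overhead and the final subtraction.
  set W := 1000 * 4 ^ k * N ^ 4 with hWdef
  have hM4 : (2 : ℕ) ^ (2 * k) = 4 ^ k := by rw [pow_mul]; norm_num
  have hM : 1 ≤ 4 ^ k := Nat.one_le_pow _ _ (by omega)
  have hMN : 4 ^ k ≤ 4 ^ k * N ^ 4 := Nat.le_mul_of_pos_right _ (by omega)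
  have hNM : N ^ 4 ≤ 4 ^ k * N ^ 4 := Nat.le_mul_of_pos_left _ hM
  have hW : W = 1000 * (4 ^ k * N ^ 4) := by rw [hWdef, mul_assoc]
  have hkn : 2 * k * n = 2 * (k * n) := mul_assoc _ _ _
  have r1 := run_setupProg (W := W) (O := countSizeBIS.oracle (2 * k)) (n := n) (k := k)
    (l := matrixBits G.Adj) (by omega) (by omega) (by omega) (by omega)
  set s0 := State.init (unaryThen n (unaryThen k (matrixBits G.Adj))) with hs0
  set s1 := (((((s0.setReg 3 n).setReg 4 k).setReg 2 (n + k + 2)).setReg 5 (2 * k)).setReg 6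
    (2 ^ (2 * k))).setReg 7 (2 * k * n + 1) with hs1
  have S2 : s1.Stores 0 (n + k + 2) (matrixBits G.Adj) := by
    have := ((State.stores_init _).unary_rest.unary_rest : s0.Stores 0 _ _)
    rw [show n + k + 2 = 0 + n + 1 + k + 1 by omega]
    exact this.of_mem_eq rfl
  have r2 := run_allMasks (W := W) (s := s1) (A := adjNat G) (k := k) (n := n) (p := n + k + 2)
    (N := N) (K := 2 * k) (M := 2 ^ (2 * k)) (by simp [hs1]) (by simp [hs1]) (by simp [hs1])
    (by simp [hs1]) (by simp [hs1])
    (fun u hu v hv => by rw [S2.matrix hu hv]; simp [adjNat, hu, hv])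
    (by simp [hs1, hs0, State.init]) le_rfl (by omega) (by omega) (by omega) (by omega) (by omega)
    (by omega)
  obtain ⟨t1, ht1, s2, a2, x1⟩ := (r1.seq r2) s0 (State.Agree.refl _ _)
  have m2 : s2.mem 2 = digitSum (adjNat G) k n (2 ^ (2 * k)) := by
    simpa using (a2 2 (by omega)).2
  -- Through `card_colourful` the number of cliques inherits the bound on the oracle's answers, so
  -- the same number of digits serves for both.
  have hcount : countCliques.count ⟨n, G, k, hk⟩ < 2 ^ (2 * k * n + 1) := by
    change Set.ncard {s : Finset (Fin n) | G.IsNClique k s} < _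
    rw [← card_colourful]
    exact ((Finset.card_le_card (Finset.filter_subset _ _)).trans card_family_le).trans_lt
      (Nat.pow_lt_pow_right one_lt_two (Nat.lt_succ_self _))
  obtain ⟨s3, r3, h3⟩ := run_subProg (W := W) (O := countSizeBIS.oracle (2 * k)) (s := s2)
    (T := 2 * k * n + 1) (M := 2 ^ (2 * k)) (r := countCliques.count ⟨n, G, k, hk⟩)
    (by rw [(a2 1 (by omega)).1]; simp [hs1, hs0, State.init])
    (by rw [(a2 7 (by omega)).1]; simp [hs1])
    (fun i => by rw [m2]; exact digitSum_le _ _ _ _ _) (by omega) (by omega)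
    (by rw [m2]; exact sum_digitSum G) hcount
  obtain ⟨t2, ht2, s4, a4, x2⟩ := r3 s2 (State.Agree.refl _ _)
  refine ⟨by omega, t1 + t2, ?_, s4, ?_, h3.of_agree a4 (by omega) (by omega)⟩
  · have hT : 2 ^ (2 * k) * (500 * N ^ 4 + 4) = 500 * (4 ^ k * N ^ 4) + 4 * 4 ^ k := by
      rw [hM4]; ring
    omega
  -- Setup and masks were run as one program, whereas `cliqueProg` groups the masks with the
  -- subtraction; the execution is reassociated.
  · cases x1 with
    | seq h h' =>
      have := Exec.seq h (Exec.seq h' x2)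
      rwa [← add_assoc] at this

theorem computable_thousand_mul_four_pow : Computable fun k : ℕ => 1000 * 4 ^ k := by
  have hpow : Primrec₂ fun a b : ℕ => a ^ b := Primrec₂.unpaired'.1 Nat.Primrec.pow
  exact (Primrec.nat_mul.comp (Primrec.const 1000)
    (hpow.comp (Primrec.const 4) Primrec.id)).to_comp

theorem sharpW1Hard_countSizeBIS : SharpW1Hard countSizeBIS :=
  ⟨cliqueProg, fun k => 1000 * 4 ^ k, fun k => 2 * k, 4, computable_thousand_mul_four_pow,
    (Primrec.nat_mul.comp (Primrec.const 2) Primrec.id).to_comp, computesWithin_cliqueProg⟩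

end Selector

/-- Counting the independent sets of size `k` in a bipartite graph, parameterised by `k`,
is #W[1]-complete. -/
theorem mainTheorem4 : SharpW1Complete countSizeBIS :=
  ⟨countSizeBIS_mem_sharpW1, Selector.sharpW1Hard_countSizeBIS⟩
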